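/- All graphs are finite and simple. $N[v]$ is the closed neighbourhood of $v$, and $cc(G)$ is the least number of cliques of $G$ that together cover $V(G)$. A graph is \emph{reduced} if no two distinct vertices have the same closed neighbourhood. A graph is a \emph{proper circular-arc} (resp. \emph{proper interval}) graph if it is the intersection graph of a family of arcs of a circle (resp. intervals of a line), none properly contained in another. A graph is \emph{locally complete 2-edge-colourable} if its edges can be coloured with two colours so that, for each vertex $v$ and each colour, the vertices joined to $v$ by edges of that colour induce a complete subgraph. Let $G$ be a graph with a \emph{round ordering} $v_1,\dots,v_n$, i.e. a circular ordering of its vertices such that for each $i$ there are $\ell,\gamma\ge 0$ with $\ell+\gamma<n$, $N[v_i]=\{v_{i-\ell},\dots,v_i,\dots,v_{i+\gamma}\}$ (subscripts modulo $n$), and both $\{v_{i-\ell},\dots,v_i\}$ and $\{v_i,\dots,v_{i+\gamma}\}$ cliques. A vertex $v_i$ is a \emph{pseudo-cutvertex} if $v_{i-1}\not\sim v_{i+1}$. Write $G[i,j]$ for the subgraph induced by $v_i,v_{i+1},\dots,v_j$ (cyclically). It is a \emph{weak block} if $v_i\ne v_j$ are pseudo-cutvertices and are the only ones in $G[i,j]$.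 Let $H$ be a graph with vertices $u_1,\dots,u_N$ in a \emph{straight ordering}, i.e. each $N_H[u_x]$ consists of consecutive vertices in the linear order, and let $k=cc(H)$. The \emph{canonical clique covering} of $H$ consists of the maximal cliques $\{u_{s_i},\dots,u_{t_i}\}$, $1\le i\le k$, where $t_i$ is the largest index such that the subgraph induced by $u_1,\dots,u_{t_i}$ has clique covering number $i$. $H$ is of \emph{type 4} if it is 2-connected, $k\ge 2$, $t_i=s_{i+1}-1$ for all $1\le i\le k-1$, and, for all $2\le i\le k-1$, the last vertex of $N_H[u_{s_i-1}]$ strictly precedes the first vertex of $N_H[u_{t_i+1}]$. ($H$ is not required to be reduced.) \textbf{Theorem.} Let $G$ be a reduced proper circular-arc graph with $cc(G)\ge 3$ that is not a proper interval graph, let $v_1,\dots,v_n$ be a round ordering of $G$, and suppose that $G$ has at least two pseudo-cutvertices. Then $G$ is locally complete 2-edge-colourable if and only if the number of pseudo-cutvertices is even and each weak block $G[i,j]$ either is a clique or, after deletion of the edge $v_iv_j$ if it is present, is of type 4 with respect to the ordering $v_i,v_{i+1},\dots,v_j$. (A weak block $G[i,j]$ that is not a clique contains the edge $v_iv_j$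 only if $v_i,v_j$ are the only two pseudo-cutvertices of $G$ and $G[j,i]$ is a clique.) -/

import Mathlib

namespace LocallyComplete

/-- The closed neighbourhood `N[u]`. -/
def closedNbhd {V : Type*} (G : SimpleGraph V) (u : V) : Set V :=
  insert u (G.neighborSet u)

/-- A graph is reduced if it has no true twins (distinct vertices with the same closed
neighbourhood). -/
def IsReduced {V : Type*} (G : SimpleGraph V) : Prop :=
  ∀ u w : V, closedNbhd G u = closedNbhd G w → u = w

/-- A 2-edge-colouring is locally complete if, for each vertex `u` and each colour, the vertices
joined to `u` by edges of that colour induce a complete subgraph. -/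
def IsLocallyComplete {V : Type*} {G : SimpleGraph V} (c : G.EdgeLabeling (Fin 2)) : Prop :=
  ∀ (u : V) (k : Fin 2), G.IsClique {x | ∃ h : G.Adj u x, c.get u x h = k}

/-- `G` has a locally complete 2-edge-colouring. -/
def IsLocallyCompleteColourable {V : Type*} (G : SimpleGraph V) : Prop :=
  ∃ c : G.EdgeLabeling (Fin 2), IsLocallyComplete c

/-- The clique covering number `cc(G)` of a finite graph: the least number of cliques that
together contain all vertices. -/
noncomputable def cc {V : Type*} (G : SimpleGraph V) : ℕ :=
  sInf {k | ∃ C : Finset (Set V),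
    C.card = k ∧ (∀ K ∈ C, G.IsClique K) ∧ ∀ x : V, ∃ K ∈ C, x ∈ K}

/-- `G` is the intersection graph of the family of sets `S`. -/
def IsIntersectionGraph {V X : Type*} (G : SimpleGraph V) (S : V → Set X) : Prop :=
  ∀ u w : V, u ≠ w → (G.Adj u w ↔ (S u ∩ S w).Nonempty)

/-- Proper interval graphs: intersection graphs of intervals in a line, none of which is properly
contained in another. -/
def IsProperIntervalGraph {V : Type*} (G : SimpleGraph V) : Prop :=
  ∃ S : V → Set ℝ, (∀ u, ∃ a b : ℝ, a ≤ b ∧ S u = Set.Icc a b) ∧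
    (∀ u w, ¬ S u ⊂ S w) ∧ IsIntersectionGraph G S

/-- A (closed) arc on the circle `ℝ/ℤ`. -/
def IsArc (A : Set (AddCircle (1 : ℝ))) : Prop :=
  ∃ a b : ℝ, a ≤ b ∧ b < a + 1 ∧ A = (fun x : ℝ => (x : AddCircle (1 : ℝ))) '' Set.Icc a b

/-- Proper circular-arc graphs: intersection graphs of arcs on a circle, none of which is properly
contained in another. -/
def IsProperCircularArcGraph {V : Type*} (G : SimpleGraph V) : Prop :=
  ∃ S : V → Set (AddCircle (1 : ℝ)), (∀ u, IsArc (S u)) ∧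
    (∀ u w, ¬ S u ⊂ S w) ∧ IsIntersectionGraph G S

/-- A round ordering: a circular ordering of the vertices, indexed by the integers modulo `n`,
such that for each `i` we have `N[v i] = {v (i - l), …, v i, …, v (i + g)}` for some `l` and `g`
(which depend on `i`), where `{v (i - l), …, v i}` and `{v i, …, v (i + g)}` are cliques. -/
def IsRoundOrdering {V : Type*} (G : SimpleGraph V) {n : ℕ} (v : ZMod n ≃ V) : Prop :=
  ∀ i : ZMod n, ∃ l g : ℕ, l + g < n ∧
    closedNbhd G (v i) =
      {x | ∃ t : ℕ, t ≤ l ∧ x = v (i - t)} ∪ {x | ∃ t : ℕ, t ≤ g ∧ x = v (i + t)} ∧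
    G.IsClique {x | ∃ t : ℕ, t ≤ l ∧ x = v (i - t)} ∧
    G.IsClique {x | ∃ t : ℕ, t ≤ g ∧ x = v (i + t)}

/-- The indices `i` for which `v i` is a pseudo-cutvertex, i.e. `v (i - 1)` and `v (i + 1)` are
not adjacent. -/
def pseudoCutvertices {V : Type*} (G : SimpleGraph V) {n : ℕ} (v : ZMod n ≃ V) : Set (ZMod n) :=
  {i | ¬ G.Adj (v (i - 1)) (v (i + 1))}

/-- The graph `G[i, i + m]` induced by `v i, v (i + 1), …, v (i + m)` (which are distinct when
`m < n`), on the positions `0, 1, …, m`. -/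
def segment {V : Type*} (G : SimpleGraph V) {n : ℕ} (v : ZMod n ≃ V) (i : ZMod n) (m : ℕ) :
    SimpleGraph (Fin (m + 1)) :=
  G.comap fun a : Fin (m + 1) => v (i + ((a : ℕ) : ZMod n))

/-- `G[i, i + m]` is a weak block: its two ends `v i` and `v (i + m)` are distinct
pseudo-cutvertices, and they are the only ones among `v i, …, v (i + m)`. -/
def IsWeakBlock {V : Type*} (G : SimpleGraph V) {n : ℕ} (v : ZMod n ≃ V) (i : ZMod n) (m : ℕ) :
    Prop :=
  0 < m ∧ m < n ∧ i ∈ pseudoCutvertices G v ∧ i + (m : ZMod n) ∈ pseudoCutvertices G v ∧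
    ∀ t : ℕ, 0 < t → t < m → i + (t : ZMod n) ∉ pseudoCutvertices G v

/-- The order of `Fin N` is a straight ordering of `H`: every closed neighbourhood consists of
consecutive vertices. -/
def IsStraight {N : ℕ} (H : SimpleGraph (Fin N)) : Prop :=
  ∀ x : Fin N, ∃ a b : Fin N, closedNbhd H x = Set.Icc a b

/-- 2-connected: at least three vertices, connected, and no cutvertex. -/
def IsTwoConnected {V : Type*} (G : SimpleGraph V) : Prop :=
  3 ≤ Nat.card V ∧ G.Connected ∧ ∀ x : V, (G.induce {x}ᶜ).Connected

/-- The cliques `H[s i, t i]`, `1 ≤ i ≤ cc(H)`, form the canonical clique covering of the straight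
ordered graph `H`: each is a maximal clique, and `t i` is the largest vertex such that the graph
induced by the vertices up to `t i` has clique covering number `i`. -/
def IsCanonicalCovering {N : ℕ} (H : SimpleGraph (Fin N)) (s t : ℕ → Fin N) : Prop :=
  ∀ i : ℕ, 1 ≤ i → i ≤ cc H →
    Maximal H.IsClique (Set.Icc (s i) (t i)) ∧
    IsGreatest {y : Fin N | cc (H.induce (Set.Iic y)) = i} (t i)

/-- Type 4, for a graph with straight ordering `0, 1, …, N - 1`. With `k = cc(H)`, the canonical
clique covering satisfies `t i = s (i + 1) - 1` for `1 ≤ i ≤ k - 1`, and, for `2 ≤ i ≤ k - 1`, the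
last vertex `a` of the closed neighbourhood of `s i - 1` precedes the first vertex `b` of the
closed neighbourhood of `t i + 1`. -/
def IsType4 {N : ℕ} (H : SimpleGraph (Fin N)) : Prop :=
  IsStraight H ∧ IsTwoConnected H ∧ 2 ≤ cc H ∧
  ∃ s t : ℕ → Fin N, IsCanonicalCovering H s t ∧
    (∀ i : ℕ, 1 ≤ i → i + 1 ≤ cc H → (t i : ℕ) + 1 = (s (i + 1) : ℕ)) ∧
    ∀ i : ℕ, 2 ≤ i → i + 1 ≤ cc H → ∀ p q a b : Fin N,
      (p : ℕ) + 1 = (s i : ℕ) → (q : ℕ) = (t i : ℕ) + 1 →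
      IsGreatest (closedNbhd H p) a → IsLeast (closedNbhd H q) b → a < b

end LocallyComplete

open LocallyComplete

/-! Unroll the circular ordering to the integers and let `r a` be the last forward neighbour of
position `a`. Then `r` is monotone and commutes with translation by `n`. Since `G` is not proper
interval, `a < r a`: a gap would let the circle be cut into a line. Since `cc G ≥ 3`, two successive
forward cliques never go all the way round (`exists_isRoundReach`). In these terms `a` is a
pseudo-cutvertex iff `r (a - 1) = a`, so no forward edge jumps over one, and a colouring is locally
complete iff the two edges of every induced path on three vertices get different colours.

Necessity. Write D(x) for the colour of the edge from `x` to `r x`. Inside a weak block, D(a) ≠ D(b)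
for adjacent `a < b` with `r a < r b`, provided some `r u` lies in `[a, b)`
(`IsPathColouring.ne_of_lt`); reducedness supplies such separators. D thus properly 2-colours an
auxiliary graph, which therefore has no triangle. Running the greedy clique covering through the
block, each failure of a type 4 condition yields a triangle (`IsPathColouring.greedy_step`). The
same induction carries the colour to the far end of the block: the edges leaving consecutive
pseudo-cutvertices have different colours (`IsPathColouring.next_ne`), which forces an even number
of them.

Sufficiency. In a type 4 block, colour an edge by whether its ends are separated by the canonical
covering (`IsType4.exists_colouring`); all edges at the two ends of the block are then of the
unseparated kind. Interchanging the colours in alternate blocks makes the blocks fit together at the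
pseudo-cutvertices, and evenness is what lets the alternation close up around the circle
(`IsReachOf.exists_global_colouring`). -/

namespace LocallyComplete

/-! ### Bounds for the clique covering number. -/

section CliqueCover

variable {V : Type*} {G : SimpleGraph V}

theorem cc_le_card {ι : Type*} [Fintype ι] (C : ι → Set V) (hC : ∀ i, G.IsClique (C i))
    (hcov : ∀ x, ∃ i, x ∈ C i) : cc G ≤ Fintype.card ι := by
  classical
  have h : cc G ≤ (Finset.univ.image C).card :=
    Nat.sInf_le ⟨_, rfl, by simpa using hC, by simpa using hcov⟩
  exact h.trans Finset.card_image_le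

theorem exists_cover_card_eq_cc [Finite V] (G : SimpleGraph V) : ∃ C : Finset (Set V),
    C.card = cc G ∧ (∀ K ∈ C, G.IsClique K) ∧ ∀ x : V, ∃ K ∈ C, x ∈ K := by
  classical
  have := Fintype.ofFinite V
  exact Nat.sInf_mem (s := {k | ∃ C : Finset (Set V),
    C.card = k ∧ (∀ K ∈ C, G.IsClique K) ∧ ∀ x : V, ∃ K ∈ C, x ∈ K})
    ⟨_, Finset.univ.image (fun x : V => ({x} : Set V)), rfl, by simp, by simp⟩

theorem card_le_cc [Finite V] {ι : Type*} [Fintype ι] (f : ι → V)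
    (hf : ∀ i j, i ≠ j → f i ≠ f j ∧ ¬ G.Adj (f i) (f j)) : Fintype.card ι ≤ cc G := by
  obtain ⟨C, hC, hcl, hcov⟩ := exists_cover_card_eq_cc G
  choose K hK hfK using fun i => hcov (f i)
  rw [← hC, ← Finset.card_univ]
  refine Finset.card_le_card_of_injOn K (fun i _ => hK i) fun i _ j _ hij => ?_
  by_contra hne
  have h := hfK j
  rw [← hij] at h
  exact (hf i j hne).2 (hcl _ (hK i) (hfK i) h (hf i j hne).1)

theorem cc_le_of_embedding {W : Type*} [Finite W] {H : SimpleGraph W} (f : G ↪g H) :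
    cc G ≤ cc H := by
  obtain ⟨C, hC, hcl, hcov⟩ := exists_cover_card_eq_cc H
  rw [← hC, ← Fintype.card_coe]
  refine cc_le_card (fun K : C => f ⁻¹' K.1) (fun K x hx y hy hxy => ?_) fun x => ?_
  · exact f.map_adj_iff.1 (hcl _ K.2 hx hy (f.injective.ne hxy))
  · obtain ⟨K, hK, hx⟩ := hcov (f x)
    exact ⟨⟨K, hK⟩, hx⟩

theorem isClique_univ_of_cc_eq_one [Finite V] (h : cc G = 1) : G.IsClique Set.univ := by
  obtain ⟨C, hC, hcl, hcov⟩ := exists_cover_card_eq_cc G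
  obtain ⟨K, rfl⟩ := Finset.card_eq_one.1 (hC.trans h)
  have : K = Set.univ := Set.eq_univ_of_forall (by simpa using hcov)
  simpa [this] using hcl

theorem cc_induce_univ [Finite V] (s : Set V) (hs : ∀ x, x ∈ s) : cc (G.induce s) = cc G := by
  refine le_antisymm (cc_le_of_embedding (SimpleGraph.Embedding.induce s)) ?_
  exact cc_le_of_embedding (H := G.induce s)
    ⟨⟨fun x => ⟨x, hs x⟩, fun x y h => congrArg Subtype.val h⟩, Iff.rfl⟩

end CliqueCover

/-- The function `ρ` gives the last neighbour, in the order `0, …, m`, of each vertex of `H`. -/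
structure HasReach {m : ℕ} (H : SimpleGraph (Fin (m + 1))) (ρ : ℕ → ℕ) : Prop where
  mono : Monotone ρ
  le_last : ∀ x, ρ x ≤ m
  le_self : ∀ x ≤ m, x ≤ ρ x
  adj_iff : ∀ a b : Fin (m + 1), a < b → (H.Adj a b ↔ (b : ℕ) ≤ ρ a)

/-! ### Colouring one block of type 4. -/

section Sufficiency

variable {m : ℕ} {H : SimpleGraph (Fin (m + 1))} {ρ : ℕ → ℕ}

theorem HasReach.isClique_Icc (h : HasReach H ρ) (a b : Fin (m + 1)) (hab : (b : ℕ) ≤ ρ a) :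
    H.IsClique (Set.Icc a b) := by
  intro x hx y hy hxy
  rcases lt_or_gt_of_ne hxy with hlt | hlt
  · exact (h.adj_iff _ _ hlt).2 ((Fin.le_def.1 hy.2).trans (hab.trans (h.mono hx.1)))
  · exact ((h.adj_iff _ _ hlt).2 ((Fin.le_def.1 hx.2).trans (hab.trans (h.mono hy.1)))).symm

/-- A graph of type 4 has a locally complete colouring in which all edges at the two end
vertices have the same colour: edges between different cliques of the canonical covering get one
colour, the others get the other one. -/
theorem IsType4.exists_colouring (h : HasReach H ρ) (h4 : IsType4 H) :
    ∃ κ : ℕ → ℕ → Prop,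
      (∀ a b c, a < b → b < c → c ≤ m → b ≤ ρ a → c ≤ ρ b → ρ a < c → (κ a b ↔ ¬ κ b c)) ∧
      (∀ b, b ≤ ρ 0 → ¬ κ 0 b) ∧ ∀ a, a < m → m ≤ ρ a → ¬ κ a m := by
  obtain ⟨-, -, hk, s, t, hcan, hst, hsep⟩ := h4
  set k := cc H with hkdef
  have hne : ∀ i, 1 ≤ i → i ≤ k → s i ≤ t i := by
    intro i h1 h2
    by_contra hlt
    have hmax := (hcan i h1 h2).1
    rw [Set.Icc_eq_empty hlt] at hmax
    have := hmax.2 (y := {0}) (by simp) (by simp)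
    simp at this
  -- Otherwise `t i`, which is the vertex just before `s (i + 1)`, could be added to the maximal
  -- clique number `i + 1`.
  have ht1 : ∀ i, 1 ≤ i → i + 1 ≤ k → ρ (t i) < t (i + 1) := by
    intro i h1 h2
    by_contra! hle
    have hmax := (hcan (i + 1) (by omega) h2).1
    have hs := hst i h1 h2
    have hc := h.isClique_Icc _ _ hle
    have hsub := hmax.2 hc (Set.Icc_subset_Icc_left (by rw [Fin.le_def]; omega))
    have hn := hne (i + 1) (by omega) h2
    have := (hsub (show t i ∈ Set.Icc (t i) (t (i + 1)) from
      ⟨le_rfl, by rw [Fin.le_def] at hn ⊢; omega⟩)).1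
    rw [Fin.le_def] at this
    omega
  have htlt : ∀ i, 1 ≤ i → i + 1 ≤ k → (t i : ℕ) < t (i + 1) := fun i h1 h2 =>
    (h.le_self _ (by omega)).trans_lt (ht1 i h1 h2)
  have htmono : ∀ i j, 1 ≤ i → i ≤ j → j ≤ k → (t i : ℕ) ≤ t j := by
    intro i j h1 hij
    induction j, hij using Nat.le_induction with
    | base => simp
    | succ j hj ih => intro hjk; exact (ih (by omega)).trans (htlt j (by omega) hjk).le
  have hclique : H.IsClique (Set.Iic (t 1)) := by
    have h1 : cc (H.induce (Set.Iic (t 1))) = 1 := (hcan 1 le_rfl (by omega)).2.1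
    intro x hx y hy hxy
    exact isClique_univ_of_cc_eq_one h1 (Set.mem_univ ⟨x, hx⟩) (Set.mem_univ ⟨y, hy⟩)
      (fun h => hxy (congrArg Subtype.val h))
  have hs1 : s 1 = 0 := by
    have := (hcan 1 le_rfl (by omega)).1.2 hclique (fun x hx => hx.2)
      (show (0 : Fin (m + 1)) ∈ Set.Iic (t 1) from Fin.zero_le _)
    exact le_antisymm this.1 (Fin.zero_le _)
  have ht1ρ : ρ 0 ≤ t 1 := by
    have hmax := (hcan 1 le_rfl (by omega)).1
    rw [hs1] at hmax
    have hle : ((⟨ρ 0, by have := h.le_last 0; omega⟩ : Fin (m + 1)) : ℕ) ≤ ρ (0 : Fin (m + 1)) :=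
      le_rfl
    by_contra! hlt
    have := (hmax.2 (h.isClique_Icc _ _ hle) (Set.Icc_subset_Icc_right
      (by rw [Fin.le_def]; exact hlt.le)) (show _ ∈ Set.Icc _ _ from ⟨Fin.zero_le _, le_rfl⟩)).2
    rw [Fin.le_def] at this
    simp only at this
    omega
  have htk : (t k : ℕ) = m := by
    have := (hcan k (by omega) le_rfl).2.2 (show Fin.last m ∈ _ from
      cc_induce_univ (G := H) (Set.Iic (Fin.last m)) Fin.le_last)
    rw [Fin.le_def] at this
    simp at this
    omega
  refine ⟨fun a b => ∃ i, 1 ≤ i ∧ i + 1 ≤ k ∧ a ≤ t i ∧ (t i : ℕ) < b, ?_, ?_, ?_⟩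
  · intro a b c hab hbc hcm hba hcb hac
    constructor
    · rintro ⟨i, hi1, hik, hai, hib⟩ ⟨j, hj1, hjk, hbj, hjc⟩
      have hij : i < j := by
        by_contra! hle
        have := htmono j i hj1 hle (by omega)
        omega
      have hm := htmono (i + 1) j (by omega) hij (by omega)
      have hρ := h.mono hai
      have hρi := ht1 i hi1 hik
      -- If both edges of the path cross the covering, `b` is adjacent to the vertex before clique
      -- `i + 1` and to the vertex after it, against the separation condition of type 4.
      let q : Fin (m + 1) := ⟨t (i + 1) + 1, by omega⟩
      let b' : Fin (m + 1) := ⟨b, by omega⟩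
      have hbp : b' ∈ closedNbhd H (t i) := Or.inr ((h.adj_iff _ _ (by
        rw [Fin.lt_def]; exact hib)).2 (by simp only [b']; omega))
      have hbq : b' ∈ closedNbhd H q := Or.inr ((h.adj_iff b' q (by
        rw [Fin.lt_def]; simp only [b', q]; omega)).2 (by simp only [b', q]; omega)).symm
      obtain ⟨x, hx⟩ := (closedNbhd H (t i)).toFinite.exists_maximal ⟨_, hbp⟩
      obtain ⟨y, hy⟩ := (closedNbhd H q).toFinite.exists_minimal ⟨_, hbq⟩
      have hx' : IsGreatest (closedNbhd H (t i)) x :=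
        ⟨hx.1, fun z hz => le_of_not_gt fun hlt => (hx.2 hz hlt.le).not_gt hlt⟩
      have hy' : IsLeast (closedNbhd H q) y :=
        ⟨hy.1, fun z hz => le_of_not_gt fun hlt => (hy.2 hz hlt.le).not_gt hlt⟩
      have := hsep (i + 1) (by omega) (by omega) (t i) q x y (hst i hi1 hik) rfl hx' hy'
      exact absurd ((hy'.2 hbq).trans (hx'.2 hbp)) (not_le.2 this)
    · intro hn
      by_contra hn'
      push Not at hn hn'
      -- If neither edge crosses, all three vertices lie in the covering clique that contains `a`,
      -- so the path is not induced.
      have hex : ∃ i, 1 ≤ i ∧ i ≤ k ∧ a ≤ t i := ⟨k, by omega, le_rfl, by omega⟩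
      classical
      obtain ⟨hi1, hik, hai⟩ := Nat.find_spec hex
      have hmin := fun j => Nat.find_min (m := j) hex
      set i := Nat.find hex
      have hsi : (s i : ℕ) ≤ a := by
        rcases Nat.lt_or_ge 1 i with hlt | hle
        · have h1 := hmin (i - 1) (by omega)
          have h2 := hst (i - 1) (by omega) (by omega)
          rw [Nat.sub_add_cancel hi1] at h2
          by_contra! hh
          exact h1 ⟨by omega, by omega, by omega⟩
        · have : i = 1 := by omega
          simp [this, hs1]
      have hct : c ≤ t i := by
        rcases Nat.lt_or_ge i k with hlt | hle
        · have h1 := hn' i hi1 hlt hai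
          exact hn i hi1 hlt h1
        · have : i = k := by omega
          rw [this]; omega
      have := (hcan i hi1 hik).1.1 (show (⟨a, by omega⟩ : Fin (m + 1)) ∈ Set.Icc _ _ from
        ⟨by rw [Fin.le_def]; exact hsi, by rw [Fin.le_def]; exact hai⟩)
        (show (⟨c, by omega⟩ : Fin (m + 1)) ∈ Set.Icc _ _ from
        ⟨by rw [Fin.le_def]; simp only; omega, by rw [Fin.le_def]; exact hct⟩)
        (by simp; omega)
      rw [h.adj_iff _ _ (by rw [Fin.lt_def]; simp only; omega)] at this
      simp only at this
      omega
  · rintro b hb ⟨i, hi1, hik, hai, hib⟩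
    have := htmono 1 i le_rfl hi1 (by omega)
    omega
  · rintro a ham hma ⟨i, hi1, hik, hai, hib⟩
    have h1 := htmono i (k - 1) hi1 (by omega) (by omega)
    have h2 := ht1 (k - 1) (by omega) (by omega)
    rw [Nat.sub_add_cancel (by omega)] at h2
    have h3 := h.mono (hai.trans h1)
    omega

end Sufficiency

/-! ### The greedy clique covering and a criterion for type 4. -/

section Greedy

variable {m : ℕ} {H : SimpleGraph (Fin (m + 1))} {ρ : ℕ → ℕ}

/-- The first vertices of the cliques of the greedy clique covering. -/
def greedyStart (ρ : ℕ → ℕ) : ℕ → ℕ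
  | 0 => 0
  | i + 1 => ρ (greedyStart ρ i) + 1

theorem HasReach.greedyStart_le (h : HasReach H ρ) (i : ℕ) : greedyStart ρ i ≤ m + 1 := by
  cases i with
  | zero => simp [greedyStart]
  | succ i => simpa [greedyStart] using h.le_last _

theorem HasReach.greedyStart_mono (h : HasReach H ρ) : Monotone (greedyStart ρ) := by
  refine monotone_nat_of_le_succ fun i => ?_
  have h1 := h.greedyStart_le i
  rw [greedyStart]
  rcases Nat.lt_or_ge m (greedyStart ρ i) with hlt | hle
  · have h2 := h.mono hlt.le
    have h3 := h.le_self m le_rfl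
    omega
  · have := h.le_self _ hle
    omega

theorem HasReach.cc_Iic_le (h : HasReach H ρ) {i : ℕ} {y : Fin (m + 1)}
    (hy : (y : ℕ) ≤ ρ (greedyStart ρ i)) : cc (H.induce (Set.Iic y)) ≤ i + 1 := by
  classical
  rw [← Fintype.card_fin (i + 1)]
  refine cc_le_card (fun j => {x : Set.Iic y | greedyStart ρ j ≤ (x.1 : ℕ) ∧
    (x.1 : ℕ) ≤ ρ (greedyStart ρ j)}) (fun j a ha b hb hab => ?_) fun x => ?_
  · have hab' : a.1 ≠ b.1 := fun h => hab (Subtype.ext h)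
    rw [SimpleGraph.comap_adj]
    rcases lt_or_gt_of_ne hab' with hlt | hlt
    · exact (h.adj_iff _ _ hlt).2 (hb.2.trans (h.mono ha.1))
    · exact ((h.adj_iff _ _ hlt).2 (ha.2.trans (h.mono hb.1))).symm
  · have hex : ∃ j, (x.1 : ℕ) ≤ ρ (greedyStart ρ j) := ⟨i, (Fin.le_def.1 x.2).trans hy⟩
    have hle : Nat.find hex ≤ i := Nat.find_min' hex ((Fin.le_def.1 x.2).trans hy)
    have hmin := fun j => Nat.find_min (m := j) hex
    have hspec := Nat.find_spec hex
    refine ⟨⟨Nat.find hex, by omega⟩, ?_, hspec⟩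
    simp only
    generalize Nat.find hex = j at *
    cases j with
    | zero => simp [greedyStart]
    | succ j => have := hmin j (by omega); rw [greedyStart]; omega

/-- The starts of the first `i + 2` greedy cliques all lie in `Set.Iic y` and are pairwise
nonadjacent. With `HasReach.cc_Iic_le` this identifies the greedy cliques' last vertices with the `t
i` of the canonical covering. -/
theorem HasReach.lt_cc_Iic (h : HasReach H ρ) {i : ℕ} {y : Fin (m + 1)}
    (hy : ρ (greedyStart ρ i) < (y : ℕ)) : i + 1 < cc (H.induce (Set.Iic y)) := by
  have hle : ∀ j < i + 2, greedyStart ρ j ≤ y := fun j hj =>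
    (h.greedyStart_mono (Nat.le_of_lt_succ hj)).trans hy
  have hlt : ∀ j l, j < l → ρ (greedyStart ρ j) < greedyStart ρ l := fun j l hjl =>
    h.greedyStart_mono hjl
  have hself : ∀ j < i + 2, greedyStart ρ j ≤ ρ (greedyStart ρ j) := fun j hj =>
    h.le_self _ (by have := hle j hj; omega)
  change i + 2 ≤ _
  rw [← Fintype.card_fin (i + 2)]
  refine card_le_cc (fun j : Fin (i + 2) =>
    (⟨⟨greedyStart ρ j, by have := hle j j.2; omega⟩, Fin.le_def.2 (hle j j.2)⟩ : Set.Iic y)) ?_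
  have key : ∀ j l : Fin (i + 2), j < l → ∀ (hj : greedyStart ρ j < m + 1)
      (hl : greedyStart ρ l < m + 1), (⟨_, hj⟩ : Fin (m + 1)) ≠ ⟨_, hl⟩ ∧
        ¬ H.Adj ⟨_, hj⟩ ⟨_, hl⟩ := by
    intro j l hjl hj hl
    have h1 := hlt j l hjl
    have h2 := hself j j.2
    refine ⟨by simp; omega, fun hadj => ?_⟩
    rw [h.adj_iff _ _ (by rw [Fin.lt_def]; simp only; omega)] at hadj
    simp only at hadj
    omega
  intro j l hjl
  rcases lt_or_gt_of_ne hjl with hlt | hlt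
  · have := key j l hlt (by have := hle j j.2; omega) (by have := hle l l.2; omega)
    exact ⟨fun e => this.1 (congrArg Subtype.val e), this.2⟩
  · have := key l j hlt (by have := hle l l.2; omega) (by have := hle j j.2; omega)
    exact ⟨fun e => this.1 (congrArg Subtype.val e).symm, fun e => this.2 e.symm⟩

theorem HasReach.isStraight (h : HasReach H ρ) : IsStraight H := by
  classical
  intro x
  have hex : ∃ y : ℕ, (x : ℕ) ≤ ρ y := ⟨x, h.le_self _ (by omega)⟩
  have hle : Nat.find hex ≤ x := Nat.find_min' hex (h.le_self _ (by omega))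
  have hiff : ∀ y : ℕ, Nat.find hex ≤ y ↔ (x : ℕ) ≤ ρ y := fun y =>
    ⟨fun hy => (Nat.find_spec hex).trans (h.mono hy), fun hy => Nat.find_min' hex hy⟩
  refine ⟨⟨Nat.find hex, by omega⟩, ⟨ρ x, by have := h.le_last x; omega⟩, ?_⟩
  have hx := h.le_self x (by omega)
  ext y
  simp only [closedNbhd, Set.mem_insert_iff, SimpleGraph.mem_neighborSet, Set.mem_Icc, Fin.le_def]
  rcases lt_trichotomy y x with hlt | rfl | hlt
  · rw [H.adj_comm, h.adj_iff _ _ hlt, hiff]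
    simp only [hlt.ne, false_or]
    rw [Fin.lt_def] at hlt
    omega
  · simp only [true_or, true_iff]
    exact ⟨hle, hx⟩
  · rw [h.adj_iff _ _ hlt]
    simp only [hlt.ne', false_or]
    rw [Fin.lt_def] at hlt
    omega

theorem HasReach.isTwoConnected (h : HasReach H ρ) (hm : 2 ≤ m)
    (hsucc : ∀ x < m, x < ρ x) (hint : ∀ x, x + 2 ≤ m → x + 2 ≤ ρ x) : IsTwoConnected H := by
  have key : ∀ S : Set (Fin (m + 1)), (∀ a b, a ∉ S → b ∉ S → a = b) →
      (H.induce S).Preconnected := by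
    intro S hS
    have hlt : ∀ d : ℕ, ∀ a b : S, (a.1 : ℕ) ≤ b.1 → (b.1 : ℕ) - a.1 ≤ d →
        (H.induce S).Reachable a b := by
      intro d
      induction d with
      | zero =>
        intro a b hab hd
        rw [show a = b from Subtype.ext (Fin.ext (by omega))]
      | succ d ih =>
        intro a b hab hd
        by_cases hadj : a = b ∨ (H.induce S).Adj a b
        · rcases hadj with rfl | hadj
          · rfl
          · exact hadj.reachable
        · push Not at hadj
          have hlt : a.1 < b.1 := by
            rw [Fin.lt_def]
            refine lt_of_le_of_ne hab fun e => hadj.1 (Subtype.ext (Fin.ext e))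
          have hna : ρ a.1 < b.1 := by
            have := hadj.2
            rw [SimpleGraph.comap_adj] at this
            erw [h.adj_iff _ _ hlt] at this
            omega
          have h1 := hsucc a.1 (by omega)
          have h2 := hint a.1 (by omega)
          -- At most one vertex is missing from `S`, so a step of length 1 or 2 always lands in `S`.
          obtain ⟨c, hcS, hac, hca⟩ : ∃ c ∈ S, a.1 < c ∧ (c : ℕ) ≤ a.1 + 2 := by
            by_cases hc : (⟨a.1 + 1, by omega⟩ : Fin (m + 1)) ∈ S
            · exact ⟨_, hc, by rw [Fin.lt_def]; simp, by simp⟩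
            · have hb : (b.1 : ℕ) ≠ a.1 + 1 := fun e =>
                hc (by convert b.2; exact e.symm)
              have hab2 := Fin.lt_def.1 hlt
              refine ⟨⟨a.1 + 2, by omega⟩, ?_, by rw [Fin.lt_def]; simp, by simp⟩
              by_contra hc'
              simpa using hS _ _ hc hc'
          have hadj' : (H.induce S).Adj a ⟨c, hcS⟩ := (h.adj_iff _ _ hac).2 (by omega)
          rw [Fin.lt_def] at hac
          exact hadj'.reachable.trans (ih ⟨c, hcS⟩ b (by simp only; omega) (by simp only; omega))
    intro a b
    rcases le_total (a.1 : ℕ) b.1 with hab | hab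
    · exact hlt _ a b hab le_rfl
    · exact (hlt _ b a hab le_rfl).symm
  refine ⟨by simp; omega, ⟨?_⟩, fun x => ?_⟩
  · intro a b
    obtain ⟨w⟩ := key Set.univ (by simp) ⟨a, trivial⟩ ⟨b, trivial⟩
    exact ⟨w.map (SimpleGraph.Embedding.induce Set.univ).toHom⟩
  · refine @SimpleGraph.Connected.mk _ _ (key {x}ᶜ (by simp_all)) ?_
    rcases eq_or_ne x 0 with rfl | hx
    · exact ⟨⟨Fin.last m, by simp [Fin.ext_iff]; omega⟩⟩
    · exact ⟨⟨0, hx.symm⟩⟩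

/-- The greedy covering is the canonical one as soon as its cliques are maximal. Hypothesis `h1`
says that a greedy clique cannot be extended to the left; `h2` is the separation condition, with `y`
ranging over the vertices that see past the middle clique. -/
theorem HasReach.isType4 (h : HasReach H ρ) (h0 : ρ 0 < m) (hsucc : ∀ x < m, x < ρ x)
    (hint : ∀ x, x + 2 ≤ m → x + 2 ≤ ρ x)
    (h1 : ∀ i, ρ (greedyStart ρ i) < m →
      ρ (ρ (greedyStart ρ i)) < ρ (greedyStart ρ (i + 1)))
    (h2 : ∀ i, ρ (greedyStart ρ (i + 1)) < m → ∀ y, ρ (greedyStart ρ (i + 1)) < ρ y →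
      ρ (ρ (greedyStart ρ i)) < y) : IsType4 H := by
  have hccH : ∀ i, ρ (greedyStart ρ i) < m ↔ i + 1 < cc H := by
    intro i
    have e := cc_induce_univ (G := H) (Set.Iic (Fin.last m)) Fin.le_last
    constructor
    · intro hi
      have := h.lt_cc_Iic (i := i) (y := Fin.last m) (by simpa using hi)
      omega
    · intro hi
      by_contra! hle
      have := h.cc_Iic_le (i := i) (y := Fin.last m) (by simpa using hle)
      omega
  have hm : 2 ≤ m := by
    have := hsucc 0 (by omega)
    omega
  refine ⟨h.isStraight, h.isTwoConnected hm hsucc hint, (hccH 0).1 h0,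
    -- The minimum only makes the value fit in `Fin (m + 1)`; it has no effect for `1 ≤ i ≤ cc H`.
    -- The shift by one is due to `greedyStart` being indexed from 0.
    fun i => ⟨min (greedyStart ρ (i - 1)) m, by omega⟩,
    fun i => ⟨ρ (greedyStart ρ (i - 1)), by have := h.le_last (greedyStart ρ (i - 1)); omega⟩,
    ?_, ?_, ?_⟩
  · intro i hi1 hi
    obtain ⟨i, rfl⟩ : ∃ j, i = j + 1 := ⟨i - 1, by omega⟩
    simp only [Nat.add_sub_cancel]
    have hprev : ∀ j, i = j + 1 → ρ (greedyStart ρ j) < m := fun j hj => (hccH j).2 (by omega)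
    have hsm : greedyStart ρ i ≤ m := by
      cases i with
      | zero => simp [greedyStart]
      | succ j => exact hprev j rfl
    have hmin : min (greedyStart ρ i) m = greedyStart ρ i := by omega
    simp only [hmin]
    constructor
    · refine ⟨h.isClique_Icc _ _ le_rfl, fun K hK hsub x hx => ?_⟩
      have hself := h.le_self _ hsm
      have hs := hsub ⟨le_rfl, Fin.le_def.2 hself⟩
      have ht := hsub ⟨Fin.le_def.2 hself, le_rfl⟩
      constructor
      · by_contra! hlt
        have hlt' := Fin.lt_def.1 hlt
        simp only at hlt'
        have hxt : x < (⟨ρ (greedyStart ρ i), by have := h.le_last (greedyStart ρ i); omega⟩ :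
          Fin (m + 1)) := by rw [Fin.lt_def]; simp only; omega
        have := (h.adj_iff _ _ hxt).1 (hK hx ht hxt.ne)
        simp only at this
        cases i with
        | zero => simp [greedyStart] at hlt'
        | succ j =>
          have h3 := h1 j (hprev j rfl)
          rw [greedyStart] at hlt'
          have h4 := h.mono (show (x : ℕ) ≤ ρ (greedyStart ρ j) by omega)
          omega
      · by_contra! hlt
        have hlt' := Fin.lt_def.1 hlt
        simp only at hlt'
        have hxs : (⟨greedyStart ρ i, by omega⟩ : Fin (m + 1)) < x := by
          rw [Fin.lt_def]; simp only; omega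
        have := (h.adj_iff _ _ hxs).1 (hK hs hx hxs.ne)
        simp only at this
        omega
    · constructor
      · refine le_antisymm (h.cc_Iic_le le_rfl) ?_
        cases i with
        | zero =>
          rw [Nat.one_le_iff_ne_zero]
          intro hz
          obtain ⟨C, hC, -, hcov⟩ := exists_cover_card_eq_cc (H.induce (Set.Iic
            (⟨ρ (greedyStart ρ 0), by have := h.le_last (greedyStart ρ 0); omega⟩ : Fin (m + 1))))
          rw [hz, Finset.card_eq_zero] at hC
          obtain ⟨K, hK, -⟩ := hcov ⟨0, Fin.zero_le _⟩
          simp [hC] at hK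
        | succ j =>
          refine h.lt_cc_Iic (i := j) ?_
          have h3 := h1 j (hprev j rfl)
          have h4 := h.le_self _ (hprev j rfl).le
          simp only
          omega
      · intro y hy
        by_contra! hlt
        have := h.lt_cc_Iic (i := i) (y := y) (Fin.lt_def.1 hlt)
        rw [Set.mem_ofPred_eq] at hy
        omega
  · intro i hi1 hi
    obtain ⟨i, rfl⟩ : ∃ j, i = j + 1 := ⟨i - 1, by omega⟩
    have := (hccH i).2 (by omega)
    simp only [Nat.add_sub_cancel, greedyStart]
    omega
  · intro i hi1 hi p q a b hp hq ha hb
    obtain ⟨i, rfl⟩ : ∃ j, i = j + 2 := ⟨i - 2, by omega⟩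
    have e1 := (hccH i).2 (by omega)
    have e2 := (hccH (i + 1)).2 (by omega)
    simp only [show i + 2 - 1 = i + 1 by omega] at hp hq
    have hp' : (p : ℕ) = ρ (greedyStart ρ i) := by
      have : greedyStart ρ (i + 1) = ρ (greedyStart ρ i) + 1 := rfl
      omega
    have hale : (a : ℕ) ≤ ρ p := by
      rcases ha.1 with rfl | hadj
      · exact h.le_self _ (by omega)
      · rcases lt_or_ge p a with hlt | hle
        · exact (h.adj_iff _ _ hlt).1 hadj
        · exact (Fin.le_def.1 hle).trans (h.le_self _ (by omega))
    have hqb : (q : ℕ) ≤ ρ b := by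
      rcases hb.1 with rfl | hadj
      · exact h.le_self _ (by omega)
      · rcases lt_or_ge b q with hlt | hle
        · exact (h.adj_iff _ _ hlt).1 hadj.symm
        · exact (Fin.le_def.1 hle).trans (h.le_self _ (by omega))
    have := h2 i e2 b (by omega)
    rw [Fin.lt_def]
    rw [hp'] at hale
    omega

end Greedy

/-- The properties of the function sending each position of a round ordering, lifted to the
integers, to the position of its last neighbour. -/
structure IsRoundReach (n : ℕ) (r : ℤ → ℤ) : Prop where
  mono : Monotone r
  add_period : ∀ a, r (a + n) = r a + n
  lt_self : ∀ a, a < r a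
  cover : ∀ a, r (r a + 1) < a + n - 1

/-- `p` and `q` are consecutive pseudo-cutvertices. -/
structure IsReachBlock (n : ℕ) (r : ℤ → ℤ) (p q : ℤ) : Prop where
  lt : p < q
  lt_period : q < p + n
  left : r (p - 1) = p
  right : r (q - 1) = q
  inner : ∀ x, p < x → x < q → x < r (x - 1)

/-- Edges that form an induced path have different colours. -/
def IsPathColouring (n : ℕ) (r : ℤ → ℤ) (col : ℤ → ℤ → Bool) : Prop :=
  ∀ a b c, a < b → b ≤ r a → b < c → c ≤ r b → r a < c → r c < a + n → col a b ≠ col b c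

theorem _root_.Bool.eq_of_ne_of_ne {a b c : Bool} (h : a ≠ c) (h' : b ≠ c) : a = b := by
  decide +revert

/-! ### Colours forced inside a weak block. -/

section Necessity

variable {n : ℕ} {r : ℤ → ℤ} {p q : ℤ} {col : ℤ → ℤ → Bool}

/-- Since `p - 1` sees no further than `p`, the vertices `p - 1, p, b` form an induced path. Hence
all forward edges at a pseudo-cutvertex have one colour, and by `end_ne` all backward edges have the
other. -/
theorem IsPathColouring.start_ne (hr : IsRoundReach n r) (hc : IsPathColouring n r col)
    (hp : r (p - 1) = p) {b : ℤ} (hb : p < b) (hbr : b ≤ r p) : col p b ≠ col (p - 1) p := by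
  have h1 := hr.mono hbr
  have h2 := hr.mono (show r p ≤ r p + 1 by omega)
  have h3 := hr.cover p
  exact (hc (p - 1) p b (by omega) hp.ge hb hbr (by omega) (by omega)).symm

theorem IsPathColouring.end_ne (hr : IsRoundReach n r) (hc : IsPathColouring n r col)
    (hq : r (q - 1) = q) {a : ℤ} (ha : a < q) (har : q ≤ r a) : col a q ≠ col q (q + 1) := by
  have h1 := hr.mono (show a ≤ q - 1 by omega)
  have h2 := hr.cover a
  have h3 := hr.lt_self q
  have h4 := hr.mono (show q + 1 ≤ r a + 1 by omega)
  exact hc a q (q + 1) ha har (by omega) (by omega) (by omega) (by omega)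

theorem IsReachBlock.le_right (hr : IsRoundReach n r) (hb : IsReachBlock n r p q) {x : ℤ}
    (hx : x < q) : r x ≤ q := by
  have := hr.mono (show x ≤ q - 1 by omega)
  have := hb.right
  omega

/-- Nothing reaches over the pseudo-cutvertices `q` and `p + n`, so an edge closing up around the
rest of the circle can only join the two ends. The rest is then one clique, and `cover` applied at
`q` keeps `r (p + 1)` away from `q`. -/
theorem IsReachBlock.lt_of_wrap (hr : IsRoundReach n r) (hb : IsReachBlock n r p q)
    {a c : ℤ} (hpa : p ≤ a) (_ : r a < c) (hcq : c ≤ q) (hw : a + n ≤ r c) :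
    a = p ∧ c = q ∧ r (p + 1) < q - 1 := by
  have hlt := hb.lt_period
  have hleft := hb.left
  have hn : r (p - 1 + n) = p + n := by rw [hr.add_period]; omega
  have hc : c = q := by
    by_contra hne
    have := hb.le_right hr (show c < q by omega)
    omega
  subst hc
  have h1 := hr.mono (show c ≤ p - 1 + n by omega)
  have h2 := hr.cover c
  have h3 := hr.mono (show p + n + 1 ≤ r c + 1 by omega)
  have h4 := hr.add_period (p + 1)
  rw [show p + 1 + n = p + n + 1 by ring] at h4
  exact ⟨by omega, rfl, by omega⟩

/-- The path `a, x, r x` is induced unless its ends are adjacent the other way round. In that case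
`a = p` and `r x = q`, and the inequality is obtained from the induced paths through `x` that use `p
+ 1` or `q - 1` instead of these ends. -/
theorem IsPathColouring.left_ne (hr : IsRoundReach n r) (hc : IsPathColouring n r col)
    (hb : IsReachBlock n r p q) {a x : ℤ} (hpa : p ≤ a) (hax : a < x) (hxa : x ≤ r a)
    (hxq : x < q) (hlt : r a < r x) : col a x ≠ col x (r x) := by
  have hxr := hr.lt_self x
  have hrx := hb.le_right hr hxq
  by_cases hw : r (r x) < a + n
  · exact hc a x (r x) hax hxa hxr le_rfl hlt hw
  · obtain ⟨rfl, hq, h1⟩ := hb.lt_of_wrap hr hpa hlt hrx (by omega)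
    have hm := hr.mono (show a ≤ a + 1 by omega)
    have hax1 : a + 1 ≠ x := by rintro rfl; omega
    have hnw : ∀ b c, a ≤ b → r b < c → c ≤ q → ¬ (b = a ∧ c = q) → r c < b + n := by
      intro b c h2 h3 h4 h5
      by_contra! h6
      obtain ⟨h7, h8, -⟩ := hb.lt_of_wrap hr h2 h3 h4 h6
      exact h5 ⟨h7, h8⟩
    have e1 := hc a x (q - 1) hax hxa (by omega) (by omega) (by omega)
      (hnw _ _ le_rfl (by omega) (by omega) (by omega))
    have e2 := hc (a + 1) x (q - 1) (by omega) (by omega) (by omega) (by omega) (by omega)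
      (hnw _ _ (by omega) (by omega) (by omega) (by omega))
    have e3 := hc (a + 1) x (r x) (by omega) (by omega) (by omega) (by omega) (by omega)
      (hnw _ _ (by omega) (by omega) (by omega) (by omega))
    exact fun e => e3 ((Bool.eq_of_ne_of_ne e1 e2).symm.trans e)

/-- Two transfers: the edges from `a` to `b` and to `r a` have equal colours, because both differ
from the colour of `u a` (of `(p - 1) p` if `a = p`); and the edge `a b` differs from the edge from
`b` to `r b`. -/
theorem IsPathColouring.ne_of_lt (hr : IsRoundReach n r) (hc : IsPathColouring n r col)
    (hb : IsReachBlock n r p q) {a b u : ℤ} (hpa : p ≤ a) (hab : a < b) (hbq : b ≤ q)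
    (hba : b ≤ r a) (hlt : r a < r b) (hau : a ≤ r u) (hub : r u < b) :
    col a (r a) ≠ col b (r b) := by
  have hp := hb.left
  have h1 : col a b ≠ col b (r b) := by
    rcases hbq.lt_or_eq with hbq | rfl
    · exact hc.left_ne hr hb hpa hab hba hbq hlt
    · have e1 := hc.end_ne hr hb.right hab hba
      have e2 := hc.start_ne hr hb.right (lt_add_one b) (hr.lt_self b)
      have e3 := hc.start_ne hr hb.right (hr.lt_self b) le_rfl
      exact fun e => e1 (e.trans (Bool.eq_of_ne_of_ne e3 e2))
  have h2 : col a b = col a (r a) := by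
    rcases hpa.eq_or_lt with rfl | hpa
    · have e2 := hc.start_ne hr hp hab hba
      have e3 := hc.start_ne hr hp (hr.lt_self _) le_rfl
      exact Bool.eq_of_ne_of_ne e2 e3
    · have hua : u < a := by
        by_contra! h
        have := hr.mono h
        omega
      have hpu : p ≤ u := by
        by_contra! h
        have := hr.mono (show u ≤ p - 1 by omega)
        omega
      have e1 := hc.left_ne hr hb hpu hua hau (hab.trans_le hbq) (by omega)
      have e2 : b < r a → col u a ≠ col a b := by
        intro hlt
        have hra := hb.le_right hr (show a < q by omega)
        refine hc u a b hua hau hab hba hub ?_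
        by_contra! hw
        have := (hb.lt_of_wrap hr hpu hub hbq hw).2.1
        omega
      rcases hba.eq_or_lt with rfl | hba
      · rfl
      · have := e2 hba
        exact Bool.eq_of_ne_of_ne this.symm e1.symm
  exact h2 ▸ h1

/-- Induction step along the greedy covering, for the clique from `s` to `t = r s`. The invariant
says that every vertex up to `t` seeing past `t` has D-value `k` and lies beyond `r (s - 1)`. The
conclusions are leftward maximality of the next clique and the invariant for its start `t + 1`. -/
theorem IsPathColouring.greedy_step (hr : IsRoundReach n r) (hc : IsPathColouring n r col)
    (hb : IsReachBlock n r p q)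
    (hred : ∀ x y, x < y → r x = r y → ∃ u, x ≤ r u ∧ r u < y) {s : ℤ} {k : Bool}
    (hps : p ≤ s) (hsq : r s < q)
    (hs : ∀ y, r s < r y → y ≤ r s → col y (r y) = k ∧ r (s - 1) < y) :
    (r (r s) < r (r s + 1) ∧ r (r s) < q) ∧
      (r (r s + 1) < q → ∀ y, r (r s + 1) < r y → y ≤ r (r s + 1) →
        col y (r y) = k ∧ r (r s) < y) := by
  have hD := fun a b u => hc.ne_of_lt hr hb (a := a) (b := b) (u := u)
  have hst := hr.lt_self s
  set t := r s with ht
  have htr := hr.lt_self t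
  have hzr := hr.lt_self (t + 1)
  have hinner := hb.inner t (by omega) hsq
  have htq := hb.le_right hr hsq
  have hkt := (hs t htr le_rfl).1
  -- Equality would, by reducedness, give `u` with `r u = t - 1`; then `u < s`, so `r (s - 1) ≥ t -
  -- 1`, against the invariant at `t - 1`.
  have hpred : r (t - 1) < r t := by
    refine lt_of_le_of_ne (hr.mono (by omega)) fun e => ?_
    obtain ⟨u, hu1, hu2⟩ := hred (t - 1) t (by omega) e
    have hus : u ≤ s - 1 := by
      by_contra! h
      have := hr.mono (show s ≤ u by omega)
      omega
    have := hr.mono hus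
    have := (hs (t - 1) hinner (by omega)).2
    omega
  have hkp := (hs (t - 1) hinner (by omega)).1
  have hzle := hr.mono (show t ≤ t + 1 by omega)
  -- If this fails then `r t = r (t + 1)`. Both D(t + 1) and D(r t) differ from `k`, since D(t - 1)
  -- = D(t) = `k`, and they differ from each other: impossible with two colours.
  have hlt : r t < r (t + 1) ∧ r t < q := by
    by_contra hcon
    have hzq : t + 1 < q := by omega
    have hzq' := hb.le_right hr hzq
    have heq : r t = r (t + 1) := by omega
    have hw := hr.lt_self (r t)
    have e1 := hD (t - 1) (t + 1) s (by omega) (by omega) (by omega) (by omega) (by omega)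
      (by omega) (by omega)
    have e2 := hD t (r t) s (by omega) (by omega) (by omega) (by omega) (by omega)
      (by omega) (by omega)
    have e3 := hD (t + 1) (r t) (t - 1) (by omega) (by omega) (by omega) (by omega) (by omega)
      (by omega) (by omega)
    exact e3 (Bool.eq_of_ne_of_ne (hkp ▸ e1).symm (hkt ▸ e2).symm)
  refine ⟨hlt, fun hwq y hy hyw => ?_⟩
  have hkz := hD t (t + 1) s (by omega) (by omega) (by omega) (by omega) (by omega)
      (by omega) (by omega)
  -- Otherwise `t`, `t + 1` and `r t` would have pairwise different D-values.
  have hyt : r t < y := by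
    by_contra! hle
    have hx := hr.mono hle
    have e1 := hD t (r t) s (by omega) (by omega) (by omega) (by omega) (by omega)
      (by omega) (by omega)
    have e2 := hD (t + 1) (r t) (t - 1) (by omega) (by omega) (by omega) (by omega) (by omega)
      (by omega) (by omega)
    exact e2 (Bool.eq_of_ne_of_ne (hkt ▸ hkz).symm (hkt ▸ e1).symm)
  refine ⟨?_, hyt⟩
  have e1 := hD (t + 1) y t (by omega) (by omega) (by omega) (by omega) (by omega)
      (by omega) (by omega)
  exact Bool.eq_of_ne_of_ne e1.symm (hkt ▸ hkz)

theorem IsPathColouring.last_ne (hr : IsRoundReach n r) (hc : IsPathColouring n r col)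
    (hb : IsReachBlock n r p q) {s : ℤ} {k : Bool}
    (hps : p ≤ s) (hsq : r s < q) (hkt : col (r s) (r (r s)) = k)
    (hlt : r (r s) < r (r s + 1)) (hlast : q ≤ r (r s + 1)) (hq : r (r s) < q) :
    col (q - 1) q ≠ k := by
  have hst := hr.lt_self s
  have htr := hr.lt_self (r s)
  have h1 := hb.le_right hr (show r s + 1 < q by omega)
  have h2 := hc.ne_of_lt hr hb (a := r s) (b := r s + 1) (u := s) (by omega) (by omega) (by omega)
    (by omega) (by omega) (by omega) (by omega)
  have e1 := hc.end_ne hr hb.right (a := r s + 1) (by omega) (by omega)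
  have e2 := hc.end_ne hr hb.right (a := q - 1) (by omega) hb.right.ge
  rw [hkt, show r (r s + 1) = q by omega, Bool.eq_of_ne_of_ne e1 e2] at h2
  exact h2.symm

end Necessity

/-! ### Weak blocks as linearly ordered graphs. -/

section Block

variable {n m : ℕ} {r : ℤ → ℤ} {p : ℤ} {col : ℤ → ℤ → Bool} {H : SimpleGraph (Fin (m + 1))}

/-- The last neighbours in the block `p, …, p + m`, relative to `p`. -/
def blockReach (r : ℤ → ℤ) (p : ℤ) (m x : ℕ) : ℕ :=
  (min (r (p + x)) (p + m) - p).toNat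

theorem IsRoundReach.hasReach_block (hr : IsRoundReach n r)
    (hH : ∀ a b : Fin (m + 1), a < b → (H.Adj a b ↔ p + (b : ℕ) ≤ r (p + (a : ℕ)))) :
    HasReach H (blockReach r p m) where
  mono x y hxy := by
    have := hr.mono (show p + (x : ℤ) ≤ p + y by omega)
    simp only [blockReach]
    omega
  le_last x := by simp only [blockReach]; omega
  le_self x hx := by
    have := hr.lt_self (p + x)
    simp only [blockReach]
    omega
  adj_iff a b hab := by
    rw [hH a b hab]
    have := hr.lt_self (p + (a : ℕ))
    simp only [blockReach]
    omega

theorem IsRoundReach.coe_blockReach (hr : IsRoundReach n r) (x : ℕ) :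
    (blockReach r p m x : ℤ) = min (r (p + x)) (p + m) - p := by
  have := hr.lt_self (p + x)
  simp only [blockReach]
  omega

/-- Iterating `greedy_step` from `p` gives the hypotheses of `HasReach.isType4`, and the constant
colour of the invariant determines the colour of the last edge of the block through `last_ne`. -/
theorem IsPathColouring.isType4_block (hr : IsRoundReach n r) (hc : IsPathColouring n r col)
    (hb : IsReachBlock n r p (p + m)) (hncl : r p < p + m)
    (hred : ∀ x y, x < y → r x = r y → ∃ u, x ≤ r u ∧ r u < y)
    (hH : ∀ a b : Fin (m + 1), a < b → (H.Adj a b ↔ p + (b : ℕ) ≤ r (p + (a : ℕ)))) :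
    IsType4 H ∧ col (p + m - 1) (p + m) = col p (r p) := by
  have h := hr.hasReach_block hH
  have hρ := hr.coe_blockReach (p := p) (m := m)
  set ρ := blockReach r p m with hρdef
  set k := !col p (r p) with hk
  have hlt : ∀ i, ρ (greedyStart ρ i) < m → r (p + greedyStart ρ i) = p + ρ (greedyStart ρ i) := by
    intro i hi
    have := hρ (greedyStart ρ i)
    omega
  have hinv : ∀ i, ρ (greedyStart ρ i) < m → ∀ y, r (p + greedyStart ρ i) < r y →
      y ≤ r (p + greedyStart ρ i) → col y (r y) = k ∧ r (p + greedyStart ρ i - 1) < y := by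
    intro i
    induction i with
    | zero =>
      intro _ y hy hyr
      simp only [greedyStart, Nat.cast_zero, add_zero] at hy hyr ⊢
      have hleft := hb.left
      have hpy : p < y := by
        by_contra! h
        have := hr.mono h
        omega
      -- At the start of the block the separator is `p - 1`, as `r (p - 1) = p`; this is also why
      -- `k` is the colour not used on the forward edges at `p`.
      refine ⟨?_, by omega⟩
      by_cases hym : y ≤ p + m
      · have := hc.ne_of_lt hr hb (a := p) (b := y) (u := p - 1) le_rfl hpy hym hyr hy
          hleft.ge (by omega)
        rw [hk]
        exact (Bool.eq_not.2 this.symm)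
      · omega
    | succ i ih =>
      intro hi
      have hi' : ρ (greedyStart ρ i) < m :=
        (h.mono (h.greedyStart_mono (Nat.le_succ i))).trans_lt hi
      have e := hlt i hi'
      have e' : p + (greedyStart ρ (i + 1) : ℕ) = r (p + greedyStart ρ i) + 1 := by
        rw [e, greedyStart]; push_cast; ring
      have hi2 := hlt (i + 1) hi
      have := (hc.greedy_step hr hb hred (s := p + greedyStart ρ i) (k := k) (by omega)
        (by omega) (ih hi')).2
      rw [e', show r (p + greedyStart ρ i) + 1 - 1 = r (p + greedyStart ρ i) by ring]
      rw [e'] at hi2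
      exact this (by omega)
  have hstep : ∀ i, ρ (greedyStart ρ i) < m →
      p + (greedyStart ρ (i + 1) : ℕ) = r (p + greedyStart ρ i) + 1 ∧
      (r (r (p + greedyStart ρ i)) < r (r (p + greedyStart ρ i) + 1) ∧
        r (r (p + greedyStart ρ i)) < p + m) := by
    intro i hi
    have e := hlt i hi
    refine ⟨?_, (hc.greedy_step hr hb hred (s := p + greedyStart ρ i) (k := k) (by omega)
        (by omega) (hinv i hi)).1⟩
    rw [e, greedyStart]; push_cast; ring
  have h0 : ρ 0 < m := by
    have := hρ 0
    simp only [Nat.cast_zero, add_zero] at this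
    omega
  constructor
  · refine h.isType4 h0 ?_ ?_ ?_ ?_
    · intro x hx
      have h1 := hρ x
      have := hr.lt_self (p + x)
      omega
    · intro x hx
      have h1 := hρ x
      rcases Nat.lt_or_ge (x + 1) m with hlt | hle
      · have := hb.inner (p + x + 1) (by omega) (by omega)
        rw [show p + (x : ℤ) + 1 - 1 = p + x by ring] at this
        omega
      · omega
    · intro i hi
      have h1 := hstep i hi
      have h2 := hρ (ρ (greedyStart ρ i))
      have h3 := hρ (greedyStart ρ (i + 1))
      rw [← hlt i hi] at h2
      rw [h1.1] at h3
      omega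
    · intro i hi y hy
      have hi' : ρ (greedyStart ρ i) < m :=
        (h.mono (h.greedyStart_mono (Nat.le_succ i))).trans_lt hi
      have h1 := hstep i hi'
      have h2 := hρ (ρ (greedyStart ρ i))
      have h3 := hlt (i + 1) hi
      have h4 := hρ y
      rw [← hlt i hi'] at h2
      have hinv1 := hinv (i + 1) hi (p + y)
      by_cases hyr : p + (y : ℤ) ≤ r (p + greedyStart ρ (i + 1))
      · have := (hinv1 (by omega) hyr).2
        rw [h1.1, show r (p + greedyStart ρ i) + 1 - 1 = r (p + greedyStart ρ i) by ring] at this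
        omega
      · rw [h1.1] at hyr
        omega
  · classical
    have hex : ∃ i, m ≤ ρ (greedyStart ρ i) := by
      by_contra! hall
      -- The starts increase strictly while the end of the block is not reached, so the covering
      -- stops.
      have : ∀ i, i ≤ greedyStart ρ i := by
        intro i
        induction i with
        | zero => simp
        | succ i ih =>
          have e := hlt i (hall i)
          have := hr.lt_self (p + greedyStart ρ i)
          rw [greedyStart]
          omega
      have h1 := this m
      have h2 := hlt m (hall m)
      have h3 := hr.lt_self (p + greedyStart ρ m)
      have h4 := hall m
      omega
    have hspec := Nat.find_spec hex
    have hmin := fun j => Nat.find_min (m := j) hex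
    set i := Nat.find hex
    obtain ⟨j, hj⟩ : ∃ j, i = j + 1 := by
      refine ⟨i - 1, ?_⟩
      by_contra hi
      rw [show i = 0 by omega] at hspec
      simp only [greedyStart] at hspec
      omega
    rw [hj] at hspec
    have hjm : ρ (greedyStart ρ j) < m := by
      have := hmin j (by omega)
      omega
    have h1 := hstep j hjm
    have e := hlt j hjm
    have h2 := hρ (greedyStart ρ (j + 1))
    rw [h1.1] at h2
    have := hc.last_ne hr hb (s := p + greedyStart ρ j) (k := k) (by omega) (by omega)
      (hinv j hjm _ (hr.lt_self _) le_rfl).1 h1.2.1 (by omega) h1.2.2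
    rw [hk] at this
    simpa using this

/-- Consecutive pseudo-cutvertices have different colours on their right edges. -/
theorem IsPathColouring.next_ne (hr : IsRoundReach n r) (hc : IsPathColouring n r col)
    (hb : IsReachBlock n r p (p + m))
    (hred : ∀ x y, x < y → r x = r y → ∃ u, x ≤ r u ∧ r u < y) :
    col (p + m) (p + m + 1) ≠ col p (p + 1) := by
  have hpr := hr.lt_self p
  have hpq := hb.lt
  have hright := hb.right
  have e1 := hc.start_ne hr hb.left hpr le_rfl
  have e2 := hc.start_ne hr hb.left (lt_add_one p) hpr
  rw [Bool.eq_of_ne_of_ne e2 e1]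
  rcases (hb.le_right hr hpq).eq_or_lt with heq | hncl
  · have := hc.end_ne hr hright hpq heq.ge
    rw [heq]
    exact this.symm
  · have := (hc.isType4_block hr hb hncl hred
      (H := SimpleGraph.fromRel fun a b => a < b ∧ p + (b : ℕ) ≤ r (p + (a : ℕ))) (by
        intro a b hab
        simp only [SimpleGraph.fromRel_adj]
        constructor
        · rintro ⟨-, h | h⟩
          · exact h.2
          · exact absurd h.1 hab.not_gt
        · exact fun h => ⟨hab.ne, Or.inl ⟨hab, h⟩⟩)).2
    rw [← this]
    exact (hc.end_ne hr hright (by omega) hright.ge).symm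

end Block

/-! ### From a round ordering to a reach function on the integers. -/

section Reach

variable {V : Type*} {G : SimpleGraph V} {n : ℕ}

theorem cc_le_two (A B : Set V) (hA : G.IsClique A) (hB : G.IsClique B)
    (h : ∀ x, x ∈ A ∨ x ∈ B) : cc G ≤ 2 := by
  refine cc_le_card (fun b : Bool => if b then A else B) ?_ fun x => ?_
  · rintro (_ | _) <;> simpa
  · rcases h x with h | h
    · exact ⟨true, by simpa⟩
    · exact ⟨false, by simpa⟩

theorem natCast_eq_natCast_of_lt [NeZero n] {s t : ℕ} (hs : s < n) (ht : t < n)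
    (h : (s : ZMod n) = t) : s = t := by
  have := congrArg ZMod.val h
  rwa [ZMod.val_cast_of_lt hs, ZMod.val_cast_of_lt ht] at this

theorem exists_add_natCast [NeZero n] (i j : ZMod n) : ∃ d : ℕ, d < n ∧ j = i + d :=
  ⟨(j - i).val, ZMod.val_lt _, by simp⟩

/-- `R i` is the forward length `γ` at `i`. Two forward cliques covering everything would give `cc G
≤ 2`, whence the last clause. It also excludes that an edge counts as forward from both ends, which
gives monotonicity: `v (i + 1)` is adjacent to the last vertex of the clique from `i`, and this
adjacency cannot go round the other way. -/
theorem exists_reach_nat [NeZero n] (v : ZMod n ≃ V) (hv : IsRoundOrdering G v)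
    (hcc : 3 ≤ cc G) : ∃ R : ZMod n → ℕ,
      (∀ i (t : ℕ), 0 < t → t < n →
        (G.Adj (v i) (v (i + t)) ↔ t ≤ R i ∨ n - t ≤ R (i + t))) ∧
      (∀ i, R i ≤ R (i + 1) + 1) ∧
      ∀ i (t : ℕ), t ≤ R i + 1 → t + R (i + t) + 1 < n := by
  choose L R hLR hN hL hR using hv
  have hadj : ∀ i (t : ℕ), 0 < t → t < n →
      (G.Adj (v i) (v (i + t)) ↔ t ≤ R i ∨ n - t ≤ L i) := by
    intro i t ht0 htn
    have hlr := hLR i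
    have hne : v (i + t) ≠ v i := by
      intro e
      have e1 : ((t : ℕ) : ZMod n) = ((0 : ℕ) : ZMod n) := by simpa using v.injective e
      have := natCast_eq_natCast_of_lt htn (by omega) e1
      omega
    have h1 : G.Adj (v i) (v (i + t)) ↔ v (i + t) ∈ closedNbhd G (v i) := by
      simp [closedNbhd, hne]
    rw [h1, hN]
    constructor
    · rintro (⟨s, hs, e⟩ | ⟨s, hs, e⟩)
      · right
        have e1 : ((t + s : ℕ) : ZMod n) = 0 := by
          have := v.injective e
          push_cast
          linear_combination this
        rw [ZMod.natCast_eq_zero_iff] at e1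
        obtain ⟨c, hc⟩ := e1
        have hc1 : c = 1 := by
          have h2 : 0 < c := Nat.pos_of_ne_zero (by rintro rfl; omega)
          have h3 : c < 2 := by by_contra!; nlinarith
          omega
        subst hc1
        omega
      · left
        have e1 := add_left_cancel (v.injective e)
        have := natCast_eq_natCast_of_lt htn (by omega) e1
        omega
    · rintro (h | h)
      · exact Or.inr ⟨t, h, rfl⟩
      · refine Or.inl ⟨n - t, h, ?_⟩
        rw [Nat.cast_sub htn.le]
        simp
  have hcF : ∀ i (t : ℕ), t ≤ R i + 1 → t + R (i + t) + 1 < n := by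
    intro i t ht
    by_contra! hcon
    have := cc_le_two _ _ (hR i) (hR (i + t)) fun x => by
      obtain ⟨j, rfl⟩ := v.surjective x
      obtain ⟨d, hd, rfl⟩ := exists_add_natCast i j
      rcases Nat.lt_or_ge (R i) d with hlt | hle
      · refine Or.inr ⟨d - t, by omega, ?_⟩
        rw [Nat.cast_sub (by omega)]
        congr 1; ring
      · exact Or.inl ⟨d, hle, rfl⟩
    omega
  have hcB : ∀ i (t : ℕ), t ≤ L i + 1 → t + L (i - t) + 1 < n := by
    intro i t ht
    by_contra! hcon
    have := cc_le_two _ _ (hL i) (hL (i - t)) fun x => by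
      obtain ⟨j, rfl⟩ := v.surjective x
      obtain ⟨d, hd, rfl⟩ : ∃ d : ℕ, d < n ∧ j = i - d := by
        obtain ⟨d, hd, e⟩ := exists_add_natCast j i
        exact ⟨d, hd, by rw [e]; ring⟩
      rcases Nat.lt_or_ge (L i) d with hlt | hle
      · refine Or.inr ⟨d - t, by omega, ?_⟩
        rw [Nat.cast_sub (by omega)]
        congr 1; ring
      · exact Or.inl ⟨d, hle, rfl⟩
    omega
  have hsymm : ∀ i (t : ℕ), 0 < t → t < n → (t ≤ R i ↔ t ≤ L (i + t)) := by
    intro i t ht0 htn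
    have e : i + t + ((n - t : ℕ) : ZMod n) = i := by
      rw [Nat.cast_sub htn.le]; simp
    have h1 := hadj i t ht0 htn
    have h2 := hadj (i + t) (n - t) (by omega) (by omega)
    rw [e, G.adj_comm, h1, show n - (n - t) = t by omega] at h2
    have h3 := hcF i t
    have h4 := hcB (i + t) t
    rw [add_sub_cancel_right] at h4
    omega
  refine ⟨R, fun i t ht0 htn => ?_, fun i => ?_, hcF⟩
  · have e : i + t + ((n - t : ℕ) : ZMod n) = i := by
      rw [Nat.cast_sub htn.le]; simp
    have := hsymm (i + t) (n - t) (by omega) (by omega)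
    rw [e] at this
    rw [hadj i t ht0 htn, this]
  · by_contra! hlt
    have hlr := hLR i
    have h1 : G.Adj (v (i + (1 : ℕ))) (v (i + (R i : ℕ))) := by
      refine hR i ⟨1, by omega, rfl⟩ ⟨R i, le_rfl, rfl⟩ fun e => ?_
      have := natCast_eq_natCast_of_lt (by omega) (by omega) (add_left_cancel (v.injective e))
      omega
    have e : i + ((1 : ℕ) : ZMod n) + ((R i - 1 : ℕ) : ZMod n) = i + (R i : ℕ) := by
      rw [Nat.cast_sub (by omega)]; push_cast; ring
    have h2 := hadj (i + (1 : ℕ)) (R i - 1) (by omega) (by omega)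
    have h3 := hsymm (i + (R i : ℕ)) (n - (R i - 1)) (by omega) (by omega)
    have e2 : i + ((R i : ℕ) : ZMod n) + ((n - (R i - 1) : ℕ) : ZMod n) = i + (1 : ℕ) := by
      rw [Nat.cast_sub (by omega), Nat.cast_sub (by omega)]; simp
    rw [e] at h2
    rw [e2] at h3
    have h4 := hcF i (R i) (by omega)
    have h5 := h2.1 h1
    rw [← h3] at h5
    push_cast at h5
    omega

/-- No edge crosses the gap after `a`, so the circle can be cut there and each vertex represented by
the interval from its position to its last neighbour. -/
theorem isProperIntervalGraph_of_gap [NeZero n] (v : ZMod n ≃ V) {r : ℤ → ℤ} (hmono : Monotone r)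
    (hper : ∀ a, r (a + n) = r a + n)
    (hadj : ∀ a b : ℤ, a < b → b < a + n →
      (G.Adj (v a) (v b) ↔ b ≤ r a ∨ a + n ≤ r b))
    (hle : ∀ a, a ≤ r a) {a : ℤ} (ha : r a = a) : IsProperIntervalGraph G := by
  let k : V → ℕ := fun x => (v.symm x - ((a + 1 : ℤ) : ZMod n)).val
  have hk : ∀ x, k x < n := fun x => ZMod.val_lt _
  have hvk : ∀ x, v ((a + 1 + k x : ℤ) : ZMod n) = x := by
    intro x
    simp [k]
  have hlt : ∀ x y, k x < k y → (G.Adj x y ↔ a + 1 + k y ≤ r (a + 1 + k x)) := by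
    intro x y hxy
    have h1 := hadj (a + 1 + k x) (a + 1 + k y) (by omega) (by have := hk y; omega)
    rw [hvk, hvk] at h1
    rw [h1]
    have h2 := hmono (show a + 1 + (k y : ℤ) ≤ a + n by have := hk y; omega)
    rw [hper, ha] at h2
    omega
  have hn : (0 : ℝ) < n := by exact_mod_cast NeZero.pos n
  -- The fraction `k x / n < 1` makes the right ends strictly increasing, so no interval contains
  -- another, without changing which integers are reached.
  let e : V → ℝ := fun x => (r (a + 1 + k x) - (a + 1) : ℤ) + (k x : ℝ) / n
  have hfrac : ∀ x, (k x : ℝ) / n < 1 := fun x => by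
    rw [div_lt_one hn]; exact_mod_cast hk x
  have hfrac0 : ∀ x, 0 ≤ (k x : ℝ) / n := fun x => by positivity
  have hke : ∀ x y, (k y : ℝ) ≤ e x ↔ a + 1 + k y ≤ r (a + 1 + k x) := by
    intro x y
    have h1 := hfrac x
    have h2 := hfrac0 x
    constructor
    · intro h
      have h3 : ((k y : ℤ) : ℝ) < ((r (a + 1 + k x) - (a + 1) + 1 : ℤ) : ℝ) := by
        push_cast
        simp only [e] at h
        push_cast at h
        linarith
      have := Int.cast_lt.1 h3
      omega
    · intro h
      have h3 : ((k y : ℤ) : ℝ) ≤ ((r (a + 1 + k x) - (a + 1) : ℤ) : ℝ) :=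
        Int.cast_le.2 (by omega)
      simp only [e]
      push_cast at h3 ⊢
      linarith
  have hse : ∀ x, (k x : ℝ) ≤ e x := fun x => (hke x x).2 (hle _)
  have hemono : ∀ x y, k x < k y → e x < e y := by
    intro x y hxy
    have h1 : ((r (a + 1 + k x) - (a + 1) : ℤ) : ℝ) ≤ ((r (a + 1 + k y) - (a + 1) : ℤ) : ℝ) :=
      Int.cast_le.2 (by have := hmono (show a + 1 + (k x : ℤ) ≤ a + 1 + k y by omega); omega)
    have h2 : (k x : ℝ) / n < (k y : ℝ) / n := by
      gcongr
    simp only [e]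
    linarith
  have hkinj : ∀ x y, k x = k y → x = y := by
    intro x y h
    rw [← hvk x, ← hvk y, h]
  refine ⟨fun x => Set.Icc (k x) (e x), fun x => ⟨_, _, hse x, rfl⟩, fun x y hxy => ?_,
    fun x y hxy => ?_⟩
  · obtain ⟨h1, h2⟩ := (Set.Icc_subset_Icc_iff (hse x)).1 hxy.1
    rcases lt_trichotomy (k x) (k y) with hlt' | heq | hlt'
    · exact absurd (Nat.cast_le.1 h1) (not_le.2 hlt')
    · rw [hkinj x y heq] at hxy
      exact hxy.2 subset_rfl
    · exact absurd h2 (not_le.2 (hemono y x hlt'))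
  · have main : ∀ x y, k x < k y →
        (G.Adj x y ↔ (Set.Icc (k x : ℝ) (e x) ∩ Set.Icc (k y : ℝ) (e y)).Nonempty) := by
      intro x y hxy
      rw [hlt x y hxy, ← hke, Set.Icc_inter_Icc, Set.nonempty_Icc]
      have h1 : (k x : ℝ) ≤ k y := by exact_mod_cast hxy.le
      have h2 := hemono x y hxy
      rw [sup_eq_right.2 h1, inf_eq_left.2 h2.le]
    rcases lt_trichotomy (k x) (k y) with hlt' | heq | hlt'
    · exact main x y hlt'
    · exact absurd (hkinj x y heq) hxy
    · rw [G.adj_comm, Set.inter_comm]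
      exact main y x hlt'

/-- The integers are the positions of a round ordering, unrolled, and `r` gives the last
neighbour of each vertex. -/
theorem exists_isRoundReach [NeZero n] (v : ZMod n ≃ V) (hv : IsRoundOrdering G v)
    (hcc : 3 ≤ cc G) (hpig : ¬ IsProperIntervalGraph G) : ∃ r : ℤ → ℤ, IsRoundReach n r ∧
      ∀ a b : ℤ, a < b → b < a + n → (G.Adj (v a) (v b) ↔ b ≤ r a ∨ a + n ≤ r b) := by
  obtain ⟨R, hadj, hmono, hcov⟩ := exists_reach_nat v hv hcc
  let r : ℤ → ℤ := fun a => a + R a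
  have hrm : Monotone r := monotone_int_of_le_succ fun a => by
    have := hmono a
    simp only [r]
    push_cast
    omega
  have hper : ∀ a, r (a + n) = r a + n := by
    intro a
    simp only [r]
    push_cast
    simp
    ring
  have hra : ∀ a b : ℤ, a < b → b < a + n → (G.Adj (v a) (v b) ↔ b ≤ r a ∨ a + n ≤ r b) := by
    intro a b hab hban
    obtain ⟨t, rfl⟩ : ∃ t : ℕ, b = a + t := ⟨(b - a).toNat, by omega⟩
    have := hadj a t (by omega) (by omega)
    simp only [r]
    push_cast
    rw [this]
    omega
  refine ⟨r, ⟨hrm, hper, fun a => ?_, fun a => ?_⟩, hra⟩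
  · by_contra! hle
    have hle' : ∀ a, a ≤ r a := fun a => by simp [r]
    exact hpig (isProperIntervalGraph_of_gap v hrm hper hra hle' (le_antisymm hle (hle' a)))
  · have h1 := hcov a (R a + 1) le_rfl
    simp only [r]
    push_cast at h1 ⊢
    rw [← add_assoc] at h1
    omega

end Reach

/-! ### Translation between the graph and its reach function. -/

section Transfer

variable {V : Type*} {G : SimpleGraph V} {n : ℕ} {v : ZMod n ≃ V} {r : ℤ → ℤ}

/-- `r` describes the graph `G` with the round ordering `v`. -/
def IsReachOf (G : SimpleGraph V) (v : ZMod n ≃ V) (r : ℤ → ℤ) : Prop :=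
  ∀ a b : ℤ, a < b → b < a + n → (G.Adj (v a) (v b) ↔ b ≤ r a ∨ a + n ≤ r b)

theorem IsRoundReach.lt_period (hr : IsRoundReach n r) (a : ℤ) : r (r a) + 1 < a + n := by
  have := hr.cover a
  have := hr.mono (show r a ≤ r a + 1 by omega)
  omega

theorem IsRoundReach.add_mul_period (hr : IsRoundReach n r) (a k : ℤ) :
    r (a + n * k) = r a + n * k := by
  induction k using Int.induction_on with
  | zero => simp
  | succ k ih => rw [mul_add, mul_one, ← add_assoc, hr.add_period, ih]; ring
  | pred k ih =>
    have := hr.add_period (a + n * (-k - 1))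
    rw [show a + n * (-k - 1) + n = a + n * (-(k : ℤ)) by ring, ih] at this
    linarith

theorem IsReachOf.adj (hr : IsRoundReach n r) (h : IsReachOf G v r) {a b : ℤ} (hab : a < b)
    (hb : b ≤ r a) : G.Adj (v a) (v b) := by
  have := hr.lt_period a
  have := hr.lt_self (r a)
  exact (h a b hab (by omega)).2 (Or.inl hb)

theorem IsReachOf.mem_pseudoCutvertices_iff (hr : IsRoundReach n r) (h : IsReachOf G v r)
    (a : ℤ) : (a : ZMod n) ∈ pseudoCutvertices G v ↔ r (a - 1) = a := by
  have h1 := hr.lt_period (a - 1)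
  have h2 := hr.lt_self (a - 1)
  have h3 := hr.cover (a - 1)
  have h4 := hr.mono (show a + 1 ≤ r (a - 1) + 1 by omega)
  have h5 := hr.lt_self (a + 1)
  have := h (a - 1) (a + 1) (by omega) (by omega)
  push_cast at this
  simp only [pseudoCutvertices, Set.mem_ofPred_eq, this]
  omega

theorem IsReachOf.isReachBlock (hr : IsRoundReach n r) (h : IsReachOf G v r) {p : ℤ} {m : ℕ}
    (hb : IsWeakBlock G v p m) : IsReachBlock n r p (p + m) := by
  obtain ⟨hm, hmn, hp, hq, hin⟩ := hb
  refine ⟨by omega, by omega, (h.mem_pseudoCutvertices_iff hr p).1 hp,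
    (h.mem_pseudoCutvertices_iff hr (p + m)).1 (by push_cast; exact hq), fun x hpx hxq => ?_⟩
  obtain ⟨t, rfl⟩ : ∃ t : ℕ, x = p + t := ⟨(x - p).toNat, by omega⟩
  have h1 := hin t (by omega) (by omega)
  have h2 := h.mem_pseudoCutvertices_iff hr (p + t)
  have h3 := hr.lt_self (p + t - 1)
  push_cast at h2
  rw [h2] at h1
  omega

theorem intCast_ne_of_lt {a b : ℤ} (hab : a < b) (hban : b < a + n) :
    (a : ZMod n) ≠ (b : ZMod n) := by
  intro e
  rw [ZMod.intCast_eq_intCast_iff_dvd_sub] at e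
  obtain ⟨c, hc⟩ := e
  have h1 : 0 < c := by by_contra!; nlinarith
  have h2 : c < 1 := by by_contra!; nlinarith
  omega

theorem exists_intCast_lift (a : ℤ) [NeZero n] (i : ZMod n) :
    ∃ b : ℤ, a ≤ b ∧ b < a + n ∧ (b : ZMod n) = i := by
  obtain ⟨d, hd, rfl⟩ := exists_add_natCast (a : ZMod n) i
  exact ⟨a + d, by omega, by omega, by push_cast; rfl⟩

/-- Without such a `u`, the vertices `x` and `y` have the same neighbours backwards as well as
forwards, so they are true twins. -/
theorem IsReachOf.exists_between (hr : IsRoundReach n r) (h : IsReachOf G v r) [NeZero n]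
    (hred : IsReduced G) (x y : ℤ) (hxy : x < y) (he : r x = r y) :
    ∃ u, x ≤ r u ∧ r u < y := by
  by_contra! hcon
  have hper := hr.lt_period x
  have hyr := hr.lt_self y
  have hrr := hr.lt_self (r x)
  refine intCast_ne_of_lt (n := n) hxy (by omega) (v.injective (hred _ _ ?_))
  ext w
  obtain ⟨j, rfl⟩ := v.surjective w
  obtain ⟨b, hxb, hbn, rfl⟩ := exists_intCast_lift x j
  simp only [closedNbhd, Set.mem_insert_iff, SimpleGraph.mem_neighborSet]
  have hadj := h.adj hr hxy (by omega)
  rcases hxb.eq_or_lt with rfl | hxb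
  · simp [hadj.symm]
  have hxne : v b ≠ v x := fun e => intCast_ne_of_lt hxb hbn (v.injective e.symm)
  rcases lt_trichotomy b y with hlt | rfl | hlt
  · have h1 := hr.mono hxb.le
    have h2 := h.adj hr hxb (by omega)
    have h3 := (h.adj hr hlt (by omega)).symm
    simp [h2, h3]
  · simp [hadj]
  · have hyne : v b ≠ v y := fun e =>
      intCast_ne_of_lt hlt (by omega) (v.injective e.symm)
    have h1 := hcon (b - n)
    have h2 := hr.add_period (b - n)
    rw [sub_add_cancel] at h2
    simp only [hxne, hyne, false_or]
    rw [h x b hxb hbn, h y b hlt (by omega)]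
    omega

/-- By `lt_of_wrap`, the only edge of the block that is not a forward edge inside it is the one
joining its ends, and that is the edge deleted. -/
theorem IsReachOf.deleteEdges_segment_adj (hr : IsRoundReach n r) (h : IsReachOf G v r) {p : ℤ}
    {m : ℕ} (hb : IsReachBlock n r p (p + m)) (hncl : r p < p + m) (a b : Fin (m + 1))
    (hab : a < b) :
    ((segment G v p m).deleteEdges {s((0 : Fin (m + 1)), Fin.last m)}).Adj a b ↔
      p + (b : ℕ) ≤ r (p + (a : ℕ)) := by
  have hlt := hb.lt_period
  rw [Fin.lt_def] at hab
  have h1 := h (p + (a : ℕ)) (p + (b : ℕ)) (by omega) (by omega)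
  push_cast at h1
  rw [SimpleGraph.deleteEdges_adj, segment, SimpleGraph.comap_adj, h1]
  have h2 : s(a, b) ∈ ({s((0 : Fin (m + 1)), Fin.last m)} : Set (Sym2 (Fin (m + 1)))) ↔
      (a : ℕ) = 0 ∧ (b : ℕ) = m := by
    rw [Set.mem_singleton_iff, Sym2.eq_iff]
    simp only [Fin.ext_iff, Fin.val_zero, Fin.val_last]
    omega
  rw [h2]
  constructor
  · rintro ⟨h3 | h3, h4⟩
    · exact h3
    · by_contra! h5
      have := hb.lt_of_wrap hr (by omega) h5 (by omega) h3
      omega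
  · intro h3
    refine ⟨Or.inl h3, fun h4 => ?_⟩
    rw [h4.1, h4.2] at h3
    simp only [Nat.cast_zero, add_zero] at h3
    omega

theorem IsReachOf.segment_eq_top_iff (hr : IsRoundReach n r) (h : IsReachOf G v r) {p : ℤ}
    {m : ℕ} (hb : IsReachBlock n r p (p + m)) : segment G v p m = ⊤ ↔ p + m ≤ r p := by
  have hlt := hb.lt_period
  have hlt' := hb.lt
  have hadj : ∀ a b : Fin (m + 1), a < b → ((segment G v p m).Adj a b ↔
      p + (b : ℕ) ≤ r (p + (a : ℕ)) ∨ p + (a : ℕ) + n ≤ r (p + (b : ℕ))) := by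
    intro a b hab
    rw [Fin.lt_def] at hab
    have h1 := h (p + (a : ℕ)) (p + (b : ℕ)) (by omega) (by omega)
    push_cast at h1
    rw [segment, SimpleGraph.comap_adj, h1]
  constructor
  · intro htop
    by_contra! hcon
    have hall : ∀ a b : Fin (m + 1), a < b →
        p + (b : ℕ) ≤ r (p + (a : ℕ)) ∨ p + (a : ℕ) + n ≤ r (p + (b : ℕ)) := by
      intro a b hab
      rw [← hadj a b hab, htop, SimpleGraph.top_adj]
      exact hab.ne
    have hm := hall 0 (Fin.last m) (by rw [Fin.lt_def]; simp; omega)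
    simp only [Fin.val_zero, Nat.cast_zero, add_zero, Fin.val_last] at hm
    -- The ends are adjacent only around the circle, so `p + 1` does not reach `q = p + m`; the two
    -- are then nonadjacent in both directions.
    have h1 := hb.lt_of_wrap hr le_rfl hcon le_rfl (by omega)
    have h2 := hr.lt_self (p + 1)
    have h3 := hall ⟨1, by omega⟩ (Fin.last m) (by rw [Fin.lt_def]; simp; omega)
    simp only [Nat.cast_one, Fin.val_last] at h3
    rcases h3 with h3 | h3
    · omega
    · have := hb.lt_of_wrap hr (by omega) (by omega) le_rfl h3
      omega
  · intro hle
    ext a b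
    rw [SimpleGraph.top_adj]
    refine ⟨fun h => h.ne, fun hne => ?_⟩
    have key : ∀ a b : Fin (m + 1), a < b → (segment G v p m).Adj a b := by
      intro a b hab
      have := hr.mono (show p ≤ p + (a : ℕ) by omega)
      exact (hadj a b hab).2 (Or.inl (by omega))
    rcases lt_or_gt_of_ne hne with hlt | hlt
    · exact key a b hlt
    · exact (key b a hlt).symm

theorem IsReachOf.exists_isPathColouring (hr : IsRoundReach n r) (h : IsReachOf G v r)
    (hcol : IsLocallyCompleteColourable G) :
    ∃ col : ZMod n → ZMod n → Bool, IsPathColouring n r fun a b => col a b := by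
  classical
  obtain ⟨c, hc⟩ := hcol
  refine ⟨fun i j => decide (∃ h : G.Adj (v i) (v j), c.get (v i) (v j) h = 0), ?_⟩
  intro x y z hxy hyx hyz hzy hxz hw heq
  have h1 := h.adj hr hxy hyx
  have h2 := h.adj hr hyz hzy
  have h3 := hr.lt_period x
  have h4 := hr.mono hyx
  have h5 := h x z (by omega) (by omega)
  have hne : v x ≠ v z := fun e => intCast_ne_of_lt (by omega) (by omega) (v.injective e)
  have heq' : c.get (v x) (v y) h1 = c.get (v y) (v z) h2 := by
    simp only [h1, h2, exists_true_left, decide_eq_decide] at heq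
    omega
  have := hc (v y) (c.get (v y) (v z) h2) ⟨h1.symm, by rw [← heq', c.get_comm]⟩ ⟨h2, rfl⟩ hne
  rw [h5] at this
  omega

theorem IsReachOf.isLocallyCompleteColourable (hr : IsRoundReach n r) (h : IsReachOf G v r)
    [NeZero n] (g : ZMod n → ZMod n → Bool)
    (hg : ∀ a b c : ℤ, a < b → b ≤ r a → b < c → c ≤ r b → r a < c → g a b ≠ g b c) :
    IsLocallyCompleteColourable G := by
  classical
  -- Every edge is forward in exactly one direction (`hor`, `hnot`), so `g` can be read in that
  -- direction. Two out-neighbours, or two in-neighbours, of a vertex are always adjacent; only the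
  -- mixed case needs `hg`.
  let F : V → V → Prop := fun x y => ∃ a b : ℤ, v a = x ∧ v b = y ∧ a < b ∧ b ≤ r a
  have hshift : ∀ (a b : ℤ), (a : ZMod n) = b → ∃ k : ℤ, b = a + n * k := by
    intro a b hab
    rw [ZMod.intCast_eq_intCast_iff_dvd_sub] at hab
    obtain ⟨k, hk⟩ := hab
    exact ⟨k, by omega⟩
  have hout : ∀ (a : ℤ) (y : V), F (v a) y → ∃ b : ℤ, v b = y ∧ a < b ∧ b ≤ r a := by
    rintro a y ⟨a', b', ha, rfl, hab, hbr⟩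
    obtain ⟨k, rfl⟩ := hshift _ _ (v.injective ha)
    refine ⟨b' + n * k, by push_cast; simp, by omega, ?_⟩
    rw [hr.add_mul_period]
    omega
  have hin : ∀ (b : ℤ) (x : V), F x (v b) → ∃ a : ℤ, v a = x ∧ a < b ∧ b ≤ r a := by
    rintro b x ⟨a', b', rfl, hb, hab, hbr⟩
    obtain ⟨k, rfl⟩ := hshift _ _ (v.injective hb)
    refine ⟨a' + n * k, by push_cast; simp, by omega, ?_⟩
    rw [hr.add_mul_period]
    omega
  have hlift : ∀ x : V, ∃ a : ℤ, v a = x := fun x => by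
    obtain ⟨a, -, -, ha⟩ := exists_intCast_lift 0 (v.symm x)
    exact ⟨a, by rw [ha]; simp⟩
  have hor : ∀ x y, G.Adj x y → F x y ∨ F y x := by
    intro x y hxy
    obtain ⟨a, rfl⟩ := hlift x
    obtain ⟨b, hab, hban, hb⟩ := exists_intCast_lift a (v.symm y)
    obtain rfl : v b = y := by rw [hb]; simp
    rcases hab.eq_or_lt with rfl | hab
    · exact absurd hxy (G.irrefl)
    · rcases (h a b hab hban).1 hxy with h1 | h1
      · exact Or.inl ⟨a, b, rfl, rfl, hab, h1⟩
      · exact Or.inr ⟨b, a + n, rfl, by push_cast; simp, by omega, h1⟩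
  have hnot : ∀ x y, F x y → ¬ F y x := by
    rintro x y ⟨a, b, rfl, rfl, hab, hbr⟩ hyx
    obtain ⟨a', ha, h1, h2⟩ := hout b _ hyx
    obtain ⟨k, rfl⟩ := hshift _ _ (v.injective ha.symm)
    have h3 := hr.lt_period a
    have h4 := hr.mono hbr
    have h5 : 0 < k := by by_contra!; nlinarith
    nlinarith
  let f : V → V → Fin 2 := fun x y =>
    if F x y then (if g (v.symm x) (v.symm y) then 0 else 1)
    else if g (v.symm y) (v.symm x) then 0 else 1
  have hf : ∀ x y, F x y → f x y = if g (v.symm x) (v.symm y) then 0 else 1 := fun x y hxy => by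
    simp [f, hxy]
  have hf' : ∀ x y, F y x → f x y = if g (v.symm y) (v.symm x) then 0 else 1 := fun x y hxy => by
    simp [f, hnot _ _ hxy]
  refine ⟨SimpleGraph.EdgeLabeling.mk (fun x y _ => f x y) fun x y hxy => ?_, ?_⟩
  · rcases hor x y hxy with h1 | h1
    · rw [hf x y h1, hf' y x h1]
    · rw [hf' x y h1, hf y x h1]
  · rintro u k x ⟨hux, hx⟩ y ⟨huy, hy⟩ hxy
    simp only [SimpleGraph.EdgeLabeling.get_mk] at hx hy
    obtain ⟨b, rfl⟩ := hlift u
    have hper := hr.lt_period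
    have hself := hr.lt_self
    have mixed : ∀ x y, F x (v b) → F (v b) y → f (v b) x = f (v b) y → G.Adj x y := by
      intro x y hxb hby heq
      rw [hf' _ _ hxb, hf _ _ hby] at heq
      obtain ⟨a, rfl, hab, hba⟩ := hin b x hxb
      obtain ⟨c, rfl, hbc, hcb⟩ := hout b y hby
      by_cases hc : c ≤ r a
      · exact h.adj hr (hab.trans hbc) hc
      · have := hg a b c hab hba hbc hcb (by omega)
        simp only [Equiv.symm_apply_apply] at heq
        revert heq this
        cases g a b <;> cases g b c <;> simp
    rcases hor _ _ hux with h1 | h1 <;> rcases hor _ _ huy with h2 | h2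
    · obtain ⟨a, rfl, ha, har⟩ := hout b x h1
      obtain ⟨c, rfl, hc, hcr⟩ := hout b y h2
      rcases lt_trichotomy a c with hlt | rfl | hlt
      · exact h.adj hr hlt (hcr.trans (hr.mono ha.le))
      · exact absurd rfl hxy
      · exact (h.adj hr hlt (har.trans (hr.mono hc.le))).symm
    · exact (mixed y x h2 h1 (hy.trans hx.symm)).symm
    · exact mixed x y h1 h2 (hx.trans hy.symm)
    · obtain ⟨a, rfl, ha, har⟩ := hin b x h1
      obtain ⟨c, rfl, hc, hcr⟩ := hin b y h2
      rcases lt_trichotomy a c with hlt | rfl | hlt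
      · exact h.adj hr hlt (by omega)
      · exact absurd rfl hxy
      · exact (h.adj hr hlt (by omega)).symm

end Transfer

/-! ### Parity of the number of pseudo-cutvertices. -/

section Parity

variable {V : Type*} {G : SimpleGraph V} {n : ℕ} {v : ZMod n ≃ V} {r : ℤ → ℤ}

theorem exists_isWeakBlock [NeZero n] (h2 : 2 ≤ (pseudoCutvertices G v).ncard) {i : ZMod n}
    (hi : i ∈ pseudoCutvertices G v) : ∃ m, IsWeakBlock G v i m := by
  classical
  obtain ⟨j, hj, hji⟩ := Set.exists_ne_of_one_lt_ncard h2 i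
  obtain ⟨d, hd, rfl⟩ := exists_add_natCast i j
  have hd0 : 0 < d := Nat.pos_of_ne_zero (by rintro rfl; simp at hji)
  have hex : ∃ m : ℕ, 0 < m ∧ i + (m : ZMod n) ∈ pseudoCutvertices G v := ⟨d, hd0, hj⟩
  have hle := Nat.find_min' hex ⟨hd0, hj⟩
  exact ⟨Nat.find hex, (Nat.find_spec hex).1, by omega, hi, (Nat.find_spec hex).2,
    fun t ht htm hmem => Nat.find_min hex htm ⟨ht, hmem⟩⟩

/-- Passing to the next pseudo-cutvertex is injective and exchanges the two classes of `f`, so these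
have equal size. -/
theorem even_ncard_pseudoCutvertices [NeZero n] (h2 : 2 ≤ (pseudoCutvertices G v).ncard)
    (f : ZMod n → Bool) (hf : ∀ i m, IsWeakBlock G v i m → f (i + m) ≠ f i) :
    Even (pseudoCutvertices G v).ncard := by
  classical
  set P := pseudoCutvertices G v with hP
  have hex : ∀ i, ∃ m, i ∈ P → IsWeakBlock G v i m := fun i => by
    by_cases hi : i ∈ P
    · obtain ⟨m, hm⟩ := exists_isWeakBlock h2 hi
      exact ⟨m, fun _ => hm⟩
    · exact ⟨0, fun h => absurd h hi⟩
  choose m hm using hex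
  have hinj : ∀ i ∈ P, ∀ j ∈ P, m i ≤ m j → i + (m i : ZMod n) = j + m j → i = j := by
    intro i hi j hj hle e
    have e' : i = j + ((m j - m i : ℕ) : ZMod n) := by
      rw [Nat.cast_sub hle]
      linear_combination e
    rcases hle.eq_or_lt with heq | hlt
    · simpa [heq] using e'
    · have hpos := (hm i hi).1
      exact absurd (e' ▸ hi) ((hm j hj).2.2.2.2 (m j - m i) (by omega) (by omega))
  have hle : ∀ b : Bool, (P ∩ {i | f i = b}).ncard ≤ (P ∩ {i | f i = !b}).ncard := by
    intro b
    refine Set.ncard_le_ncard_of_injOn (fun i => i + (m i : ZMod n)) ?_ ?_ (Set.toFinite _)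
    · rintro i ⟨hi, rfl⟩
      exact ⟨(hm i hi).2.2.2.1, Bool.eq_not.2 (hf i (m i) (hm i hi))⟩
    · rintro i ⟨hi, -⟩ j ⟨hj, -⟩ e
      rcases le_total (m i) (m j) with hij | hij
      · exact hinj i hi j hj hij e
      · exact (hinj j hj i hi hij e.symm).symm
  have heq : (P ∩ {i | f i = true}).ncard = (P ∩ {i | f i = false}).ncard :=
    le_antisymm (hle true) (hle false)
  have hunion : P = (P ∩ {i | f i = true}) ∪ (P ∩ {i | f i = false}) := by
    ext i
    cases h : f i <;> simp [h]
  have hdisj : Disjoint (P ∩ {i | f i = true}) (P ∩ {i | f i = false}) := by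
    rw [Set.disjoint_left]
    rintro i ⟨-, h1⟩ ⟨-, h3⟩
    rw [Set.mem_ofPred_eq] at h1 h3
    simp [h1] at h3
  rw [hunion, Set.ncard_union_eq hdisj (Set.toFinite _) (Set.toFinite _), heq]
  exact ⟨_, rfl⟩

theorem exists_alternating [NeZero n] (P : Set (ZMod n)) (hP : Even P.ncard) :
    ∃ e : ZMod n → Bool, (∀ i, i + 1 ∈ P → e (i + 1) ≠ e i) ∧ ∀ i, i + 1 ∉ P → e (i + 1) = e i := by
  classical
  let p : ℕ → Prop := fun t => (t : ZMod n) ∈ P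
  have hcard : Nat.count p n = P.ncard := by
    rw [Nat.count_eq_card_filter_range, ← Finset.card_image_of_injOn
      (f := fun t : ℕ => (t : ZMod n)), ← Set.ncard_coe_finset]
    · congr 1
      ext i
      simp only [Finset.coe_image, Finset.coe_filter, Finset.mem_range, Set.mem_image,
        Set.mem_ofPred_eq]
      constructor
      · rintro ⟨t, ⟨-, ht⟩, rfl⟩
        exact ht
      · intro hi
        exact ⟨i.val, ⟨ZMod.val_lt i, by simpa [p] using hi⟩, by simp⟩
    · intro s hs t ht hst
      simp only [Finset.coe_filter, Finset.mem_range, Set.mem_ofPred_eq] at hs ht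
      exact natCast_eq_natCast_of_lt hs.1 ht.1 hst
  -- Parity of the number of elements of `P` among `0, …, i`; evenness of `P.ncard` is needed only
  -- at the step from `n - 1` to `0`.
  let e : ZMod n → Bool := fun i => decide (Even (Nat.count p (i.val + 1)))
  have hstep : ∀ i, (e (i + 1) = true ↔ (e i = true ↔ i + 1 ∉ P)) := by
    intro i
    have hv := ZMod.val_lt i
    have hi : ((i.val + 1 : ℕ) : ZMod n) = i + 1 := by simp
    simp only [e, decide_eq_true_eq]
    rcases Nat.lt_or_ge (i.val + 1) n with hlt | hge
    · have hval : (i + 1).val = i.val + 1 := by rw [← hi, ZMod.val_cast_of_lt hlt]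
      rw [hval, Nat.count_succ]
      by_cases hmem : i + 1 ∈ P
      · rw [if_pos (by simpa [p] using hmem)]
        simp [Nat.even_add_one, hmem]
      · rw [if_neg (by simpa [p] using hmem)]
        simp [hmem]
    · have hn : i.val + 1 = n := by omega
      have h0 : i + 1 = 0 := by rw [← hi, hn]; simp
      rw [hn, hcard, h0, ZMod.val_zero, Nat.count_succ]
      by_cases hmem : (0 : ZMod n) ∈ P
      · simp [p, hmem, hP]
      · simp [p, hmem, hP]
  refine ⟨e, fun i hi => ?_, fun i hi => ?_⟩
  · have := hstep i
    cases h1 : e i <;> simp_all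
  · have := hstep i
    cases h1 : e i <;> cases h2 : e (i + 1) <;> simp_all

end Parity

/-! ### Colourings of single blocks and their translates. -/

section Colouring

variable {n : ℕ} {r : ℤ → ℤ}

/-- The colouring `κ` of the edges of the block `p, …, p + m` gives different colours to the edges
of an induced path, and the same colour to all edges at `p` and at `p + m`. -/
structure IsBlockColouring (r : ℤ → ℤ) (p : ℤ) (m : ℕ) (κ : ℕ → ℕ → Prop) : Prop where
  path : ∀ a b c : ℕ, a < b → b < c → c ≤ m → p + b ≤ r (p + a) → p + c ≤ r (p + b) →
    r (p + a) < p + c → (κ a b ↔ ¬ κ b c)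
  left : ∀ b : ℕ, b ≤ m → p + b ≤ r p → ¬ κ 0 b
  right : ∀ a : ℕ, a < m → p + m ≤ r (p + a) → ¬ κ a m

theorem isBlockColouring_of_clique (hr : IsRoundReach n r) {p : ℤ} {m : ℕ} (h : p + m ≤ r p) :
    IsBlockColouring r p m fun _ _ => False where
  path a b c _ _ hc _ _ hlt := by
    have := hr.mono (show p ≤ p + a by omega)
    omega
  left := by simp
  right := by simp

theorem IsType4.exists_isBlockColouring {p : ℤ} {m : ℕ} {H : SimpleGraph (Fin (m + 1))}
    (h4 : IsType4 H) (hr : IsRoundReach n r)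
    (hH : ∀ a b : Fin (m + 1), a < b → (H.Adj a b ↔ p + (b : ℕ) ≤ r (p + (a : ℕ)))) :
    ∃ κ, IsBlockColouring r p m κ := by
  obtain ⟨κ, h1, h2, h3⟩ := h4.exists_colouring (hr.hasReach_block hH)
  have hρ := hr.coe_blockReach (p := p) (m := m)
  refine ⟨κ, fun a b c hab hbc hc hba hcb hac => ?_, fun b hb hbr => ?_, fun a ha har => ?_⟩
  · have e1 := hρ a
    have e2 := hρ b
    exact h1 a b c hab hbc hc (by omega) (by omega) (by omega)
  · have e1 := hρ 0
    simp only [Nat.cast_zero, add_zero] at e1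
    exact h2 b (by omega)
  · have e1 := hρ a
    exact h3 a ha (by omega)

theorem IsBlockColouring.add_mul_period (hr : IsRoundReach n r) {p : ℤ} {m : ℕ}
    {κ : ℕ → ℕ → Prop} (h : IsBlockColouring r p m κ) (k : ℤ) :
    IsBlockColouring r (p + n * k) m κ := by
  have e : ∀ a : ℕ, r (p + n * k + a) = r (p + a) + n * k := fun a => by
    rw [← hr.add_mul_period]; congr 1; ring
  have e' := hr.add_mul_period p k
  refine ⟨fun a b c hab hbc hc hba hcb hac => ?_, fun b hb hbr => ?_, fun a ha har => ?_⟩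
  · rw [e] at hba hcb hac
    exact h.path a b c hab hbc hc (by omega) (by omega) (by omega)
  · exact h.left b hb (by omega)
  · rw [e] at har
    exact h.right a ha (by omega)

theorem IsReachBlock.add_mul_period (hr : IsRoundReach n r) {p q : ℤ} (h : IsReachBlock n r p q)
    (k : ℤ) : IsReachBlock n r (p + n * k) (q + n * k) where
  lt := by have := h.lt; omega
  lt_period := by have := h.lt_period; omega
  left := by rw [add_sub_right_comm, hr.add_mul_period, h.left]
  right := by rw [add_sub_right_comm, hr.add_mul_period, h.right]
  inner x hpx hxq := by
    have h1 := h.inner (x - n * k) (by omega) (by omega)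
    have h2 := hr.add_mul_period (x - n * k - 1) k
    rw [show x - n * k - 1 + n * k = x - 1 by ring] at h2
    omega

end Colouring

/-! ### Gluing the block colourings. -/

section Main

variable {V : Type*} {G : SimpleGraph V} {n : ℕ} {v : ZMod n ≃ V} {r : ℤ → ℤ}

/-- A forward path `a, b, c` stays in one block unless `b` is a pseudo-cutvertex. There the edges on
both sides are unseparated in their blocks, and the alternating sign `e` tells them apart. -/
theorem IsReachOf.exists_global_colouring [NeZero n] (hr : IsRoundReach n r)
    (h : IsReachOf G v r) (h2 : 2 ≤ (pseudoCutvertices G v).ncard)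
    (heven : Even (pseudoCutvertices G v).ncard)
    (hblock : ∀ (p : ℤ) (m : ℕ), IsWeakBlock G v p m → ∃ κ, IsBlockColouring r p m κ) :
    ∃ g : ZMod n → ZMod n → Bool, ∀ a b c : ℤ, a < b → b ≤ r a → b < c → c ≤ r b → r a < c →
      g a b ≠ g b c := by
  classical
  set P := pseudoCutvertices G v with hP
  have hPiff : ∀ a : ℤ, (a : ZMod n) ∈ P ↔ r (a - 1) = a := h.mem_pseudoCutvertices_iff hr
  obtain ⟨e, he, he'⟩ := exists_alternating P heven
  have hκ : ∀ p : ℤ, ∃ κ, r (p - 1) = p → ∃ m : ℕ, IsReachBlock n r p (p + m) ∧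
      IsBlockColouring r p m κ := by
    intro p
    by_cases hp : r (p - 1) = p
    · obtain ⟨m, hm⟩ := exists_isWeakBlock h2 ((hPiff p).2 hp)
      obtain ⟨κ, hκ⟩ := hblock p m hm
      exact ⟨κ, fun _ => ⟨m, h.isReachBlock hr hm, hκ⟩⟩
    · exact ⟨fun _ _ => True, fun h => absurd h hp⟩
  choose κ hκ using hκ
  -- The block colouring is chosen at one representative of each residue class, so that it is
  -- invariant under translation by `n`.
  let K : ZMod n → ℕ → ℕ → Prop := fun i => κ i.cast
  have hshift : ∀ p : ℤ, ∃ k : ℤ, p = ((p : ZMod n).cast : ℤ) + n * k := by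
    intro p
    have e1 : (((p : ZMod n).cast : ℤ) : ZMod n) = (p : ZMod n) := by simp
    rw [ZMod.intCast_eq_intCast_iff_dvd_sub] at e1
    obtain ⟨k, hk⟩ := e1
    exact ⟨k, by omega⟩
  have hK : ∀ p : ℤ, r (p - 1) = p → ∃ m : ℕ, IsReachBlock n r p (p + m) ∧
      IsBlockColouring r p m (K p) := by
    intro p hp
    obtain ⟨k, hk⟩ := hshift p
    have hp0 : r (((p : ZMod n).cast : ℤ) - 1) = ((p : ZMod n).cast : ℤ) := by
      rw [← hPiff]
      simpa using (hPiff p).2 hp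
    obtain ⟨m, hm, hmκ⟩ := hκ _ hp0
    have hcol := hmκ.add_mul_period hr k
    have hm' := hm.add_mul_period hr k
    rw [← hk] at hcol
    rw [add_right_comm, ← hk] at hm'
    exact ⟨m, hm', hcol⟩
  have hback : ∀ i : ZMod n, ∃ d : ℕ, i - (d : ZMod n) ∈ P := by
    intro i
    obtain ⟨j, hj⟩ : P.Nonempty := Set.nonempty_of_ncard_ne_zero (by omega)
    exact ⟨(i - j).val, by simpa using hj⟩
  let d : ZMod n → ℕ := fun i => Nat.find (hback i)
  have hd : ∀ p q a : ℤ, IsReachBlock n r p q → p ≤ a → a < q → (d a : ℤ) = a - p := by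
    intro p q a hb hpa haq
    have h1 : d a ≤ (a - p).toNat := by
      refine Nat.find_min' (hback a) ?_
      have := (hPiff p).2 hb.left
      have e : (a : ZMod n) - ((a - p).toNat : ZMod n) = p := by
        have : ((a - p).toNat : ℤ) = a - p := by omega
        have := congrArg (Int.cast : ℤ → ZMod n) this
        push_cast at this
        rw [this]; ring
      rwa [e]
    have h3 : (a : ZMod n) - (d a : ZMod n) ∈ P := Nat.find_spec (hback a)
    have h4 := hPiff (a - d a)
    push_cast at h4
    rw [h4] at h3
    by_contra hne
    have := hb.inner (a - d a) (by omega) (by omega)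
    omega
  have hstart : ∀ a : ℤ, ∃ p : ℤ, p ≤ a ∧ ∃ m : ℕ, a < p + m ∧ IsReachBlock n r p (p + m) ∧
      IsBlockColouring r p m (K p) := by
    intro a
    have h3 : (a : ZMod n) - (d a : ZMod n) ∈ P := Nat.find_spec (hback a)
    have h4 := hPiff (a - d a)
    push_cast at h4
    rw [h4] at h3
    obtain ⟨m, hm, hmK⟩ := hK _ h3
    refine ⟨a - d a, by omega, m, ?_, hm, hmK⟩
    by_contra! hle
    have h5 := hPiff (a - d a + m)
    have hlt := hm.lt
    have h6 : (a : ZMod n) - ((d a - m : ℕ) : ZMod n) ∈ P := by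
      have := h5.2 hm.right
      rw [Nat.cast_sub (by omega)]
      push_cast at this
      convert this using 1
      ring
    have : d a ≤ d a - m := Nat.find_min' (hback a) h6
    omega
  have he1 : ∀ p q : ℤ, IsReachBlock n r p q → ∀ t : ℕ, p + t < q →
      e ((p + t : ℤ) : ZMod n) = e p := by
    intro p q hb t
    induction t with
    | zero => simp
    | succ t ih =>
      intro hlt
      push_cast at hlt
      rw [← ih (by omega)]
      push_cast
      rw [← add_assoc]
      refine he' _ fun hmem => ?_
      have h3 := hPiff (p + t + 1)
      push_cast at h3
      rw [h3] at hmem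
      have := hb.inner (p + t + 1) (by omega) (by omega)
      omega
  have he2 : ∀ p q : ℤ, IsReachBlock n r p q → ∀ a, p ≤ a → a < q → e a = e p := by
    intro p q hb a hpa haq
    obtain ⟨t, rfl⟩ : ∃ t : ℕ, a = p + t := ⟨(a - p).toNat, by omega⟩
    exact he1 p q hb t haq
  have he3 : ∀ p q : ℤ, IsReachBlock n r p q → e q ≠ e p := by
    intro p q hb
    rw [← he2 p q hb (q - 1) (by have := hb.lt; omega) (by omega)]
    have := he ((q - 1 : ℤ) : ZMod n)
    push_cast at this ⊢
    rw [sub_add_cancel] at this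
    exact this ((hPiff q).2 hb.right)
  -- As `d i` is the distance back to the start of the block, `d i` and `d i + (j - i).val` are the
  -- positions of the two ends of the edge within that block.
  let g : ZMod n → ZMod n → Bool := fun i j =>
    xor (e i) (decide (K (i - d i) (d i) (d i + (j - i).val)))
  have hg : ∀ p : ℤ, ∀ m s t : ℕ, IsReachBlock n r p (p + m) → s < t → t ≤ m →
      g ((p + s : ℤ) : ZMod n) ((p + t : ℤ) : ZMod n) = xor (e p) (decide (K p s t)) := by
    intro p m s t hb hst htm
    have hlt := hb.lt_period
    have h1 := he2 p _ hb (p + s) (by omega) (by omega)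
    have h3 := hd p _ (p + s) hb (by omega) (by omega)
    have h4 : d ((p + s : ℤ) : ZMod n) = s := by omega
    have h5 : (((p + t : ℤ) : ZMod n) - ((p + s : ℤ) : ZMod n)).val = t - s := by
      have : ((p + t : ℤ) : ZMod n) - ((p + s : ℤ) : ZMod n) = ((t - s : ℕ) : ZMod n) := by
        rw [Nat.cast_sub hst.le]; push_cast; ring
      rw [this, ZMod.val_cast_of_lt (by omega)]
    have h6 : ((p + s : ℤ) : ZMod n) - (s : ZMod n) = p := by push_cast; ring
    simp only [g]
    rw [h1, h4, h5, h6, show s + (t - s) = t by omega]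
  refine ⟨g, fun a b c hab hba hbc hcb hac => ?_⟩
  obtain ⟨p, hpa, m, ham, hb, hbK⟩ := hstart a
  obtain ⟨s, rfl⟩ : ∃ s : ℕ, a = p + s := ⟨(a - p).toNat, by omega⟩
  have hbm := hb.le_right hr ham
  obtain ⟨t, rfl⟩ : ∃ t : ℕ, b = p + t := ⟨(b - p).toNat, by omega⟩
  obtain ⟨u, rfl⟩ : ∃ u : ℕ, c = p + u := ⟨(c - p).toNat, by omega⟩
  rw [hg p m s t hb (by omega) (by omega)]
  rcases Nat.lt_or_ge t m with hlt | hge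
  · have hcm := hb.le_right hr (show p + (t : ℤ) < p + m by omega)
    rw [hg p m t u hb (by omega) (by omega)]
    have := hbK.path s t u (by omega) (by omega) (by omega) hba hcb hac
    by_cases h1 : K p t u <;> simp [this, h1]
  · obtain rfl : t = m := by omega
    obtain ⟨m', hb', hbK'⟩ := hK (p + t) hb.right
    have hle := hb'.le_right hr hb'.lt
    have h1 := hg (p + t) m' 0 (u - t) hb' (by omega) (by omega)
    rw [show p + (t : ℤ) + ((u - t : ℕ) : ℤ) = p + u by omega] at h1
    simp only [Nat.cast_zero, add_zero] at h1
    rw [h1]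
    have h3 := hbK'.left (u - t) (by omega) (by omega)
    have h4 := hbK.right s (by omega) hba
    have h5 := he3 p _ hb
    rw [decide_eq_false h4, decide_eq_false h3]
    simpa using h5.symm

end Main

end LocallyComplete

open LocallyComplete

theorem mainTheorem7 {V : Type*} [Finite V] (G : SimpleGraph V)
    (hpca : IsProperCircularArcGraph G) (hpig : ¬ IsProperIntervalGraph G)
    (hred : IsReduced G) (hcc : 3 ≤ cc G)
    {n : ℕ} (v : ZMod n ≃ V) (hv : IsRoundOrdering G v)
    (h2 : 2 ≤ (pseudoCutvertices G v).ncard) :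
    IsLocallyCompleteColourable G ↔
      Even (pseudoCutvertices G v).ncard ∧
      ∀ (i : ZMod n) (m : ℕ), IsWeakBlock G v i m →
        segment G v i m = ⊤ ∨
        IsType4 ((segment G v i m).deleteEdges {s((0 : Fin (m + 1)), Fin.last m)}) := by
  have hn : NeZero n := ⟨by
    rintro rfl
    exact not_finite_iff_infinite.2 (Infinite.of_injective v v.injective : Infinite V) inferInstance⟩
  obtain ⟨r, hr, h⟩ := exists_isRoundReach v hv hcc hpig
  have hreach : IsReachOf G v r := h
  have hlift : ∀ i : ZMod n, ∃ p : ℤ, (p : ZMod n) = i := fun i => ⟨i.cast, by simp⟩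
  constructor
  · intro hcol
    obtain ⟨col, hc⟩ := hreach.exists_isPathColouring hr hcol
    have hred' := hreach.exists_between hr hred
    constructor
    · refine even_ncard_pseudoCutvertices h2 (fun i => col i (i + 1)) fun i m hb => ?_
      obtain ⟨p, rfl⟩ := hlift i
      have := hc.next_ne hr (hreach.isReachBlock hr hb) hred'
      push_cast at this
      exact this
    · intro i m hb
      obtain ⟨p, rfl⟩ := hlift i
      have hb' := hreach.isReachBlock hr hb
      rw [hreach.segment_eq_top_iff hr hb']
      refine or_iff_not_imp_left.2 fun hncl => ?_
      exact (hc.isType4_block hr hb' (not_le.1 hncl) hred'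
        (hreach.deleteEdges_segment_adj hr hb' (not_le.1 hncl))).1
  · rintro ⟨heven, hblocks⟩
    obtain ⟨g, hg⟩ := hreach.exists_global_colouring hr h2 heven fun p m hb => by
      have hb' := hreach.isReachBlock hr hb
      by_cases hcl : p + m ≤ r p
      · exact ⟨_, isBlockColouring_of_clique hr hcl⟩
      · rcases hblocks p m hb with htop | h4
        · exact absurd ((hreach.segment_eq_top_iff hr hb').1 htop) hcl
        · exact h4.exists_isBlockColouring hr
            (hreach.deleteEdges_segment_adj hr hb' (not_le.1 hcl))
    exact hreach.isLocallyCompleteColourable hr g hg
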